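/- Conventions. A WSSUS target is given by a random spreading function $\eta$, a generalized (mean-square) random process on the time-frequency plane defined on a probability space, with mean zero and $$\mathbb E\{\overline{\eta(t,\gamma)}\,\eta(t',\gamma')\}=\delta(t-t')\,\delta(\gamma-\gamma')\,C(t,\gamma)$$ in the sense of distributions; the integrable, compactly supported function $C$ is its scattering function (identified up to null sets). The echo of a signal $x$ is $y=Hx=\iint\eta(\tau,\gamma)M_\gamma T_\tau x\,d\tau\,d\gamma$, where $T_\tau x(t)=x(t-\tau)$ and $M_\gamma x(t)=e^{2\pi i\gamma t}x(t)$. Theorem. Let $S\subset\mathbb R^2$ be a compact set of area $M<1$ (its bounding box may have area greater than one). There exist $T,B>0$, a prime number $J$ with $JTB=1$, a $J$-periodic complex sequence $(c_k)_{k\in\mathbb Z}$ and integers $a_1,b_1,\dots,a_J,b_J$, all depending only on $S$, such that, with $R=[0,T)\times[0,B)$, $$S\subseteq G:=\bigcup_{j=1}^J\bigl(R+(a_jT,b_jB)\bigr),$$ the $J\times J$ matrix $A=\bigl[e^{-2\pi i r b_j/J}\,\overline{c_{r-a_j}}\,c_{-a_j}\bigr]_{0\le r<J,\ 1\le j\le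 J}$ is invertible, and the following holds for the echo $y=Hx$ to the single sounding signal $x=\sum_{k\in\mathbb Z}c_k\delta_{kT}$. (1) Identification. The autocorrelation of $y$ determines $C$: if two WSSUS targets have scattering functions $C$, $C'$ vanishing outside $G$ (in particular, if both are supported in $S$) and their echoes to $x$ have the same autocorrelation $\mathbb E\{\overline{y(t)}y(s)\}$, then $C=C'$ almost everywhere. (2) Reconstruction. Let $C$ be the scattering function of a WSSUS target and vanish outside $G$. Then for every $n\in\mathbb Z$, in the sense of distributions on $0<t,s<T$, $$\mathbb E\{\overline{y(t+nT)}\,y(s)\}=\Pi_n(t)\,\delta(t-s),\qquad \Pi_n(t)=\sum_{k\in\mathbb Z}\overline{c_{k+n}}\,c_k\int e^{-2\pi i\gamma nT}C(t-kT,\gamma)\,d\gamma,$$ with $\Pi_n$ integrable on $(0,T)$. With $C_j(t,\gamma)=\chi_R(t,\gamma)\,C(t+a_jT,\gamma+b_jB)$ one has $C(t,\gamma)=\sum_{j=1}^JC_j(t-a_jT,\gamma-b_jB)$, and, whenever integrable functions $\Pi_n$ satisfy $\mathbb E\{\overline{y(t+nT)}\,y(s)\}=\Pi_n(t)\,\delta(t-s)$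 on $0<t,s<T$ for all $n$, then with $V=A^{-1}$ $$C_j(t,\gamma)=\sum_{r=0}^{J-1}V_{jr}\,\frac1B\sum_{m\in\mathbb Z}e^{2\pi i\gamma T(mJ+r)}\,\Pi_{mJ+r}(t),\qquad j=1,\dots,J.$$ Here the series converge in the sense of distributions on $(0,T)\times(0,B)$; if moreover $C\in L^2$, the formula holds with unconditional convergence in $L^2(R)$. -/

import Mathlib

open MeasureTheory Filter Topology
open scoped ContDiff ComplexConjugate ENNReal

noncomputable section

/-- The complex exponential `e^{2π i x}`. -/
def expi (x : ℝ) : ℂ := Complex.exp (2 * Real.pi * Complex.I * x)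

/-- Test functions: smooth and compactly supported. -/
def IsTestFunction {E : Type*} [NormedAddCommGroup E] [NormedSpace ℝ E] (φ : E → ℂ) : Prop :=
  ContDiff ℝ ∞ φ ∧ HasCompactSupport φ

/-- The space of all smooth functions on the delay-Doppler plane. Compactly supported
distributions, deterministic or random, are linear on this space. -/
def SmoothFn : Submodule ℂ (ℝ × ℝ → ℂ) where
  carrier := {f | ContDiff ℝ ∞ f}
  add_mem' {f g} hf hg := by
    have hf : ContDiff ℝ ∞ f := hf
    have hg : ContDiff ℝ ∞ g := hg
    exact hf.add hg
  zero_mem' := by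
    show ContDiff ℝ ∞ (fun _ : ℝ × ℝ => (0 : ℂ))
    exact contDiff_const
  smul_mem' a f hf := by
    have hf : ContDiff ℝ ∞ f := hf
    exact hf.const_smul a

/-- `E[conj X · Y]` for square-integrable complex random variables. -/
def correlation {Ω : Type*} [MeasurableSpace Ω] {P : Measure Ω} (X Y : Lp ℂ 2 P) : ℂ :=
  ∫ w, conj (X w) * Y w ∂P

/-- A random spreading function (a generalized, mean-square random process on the delay-Doppler
plane, paired with smooth functions): `η φ` stands for `∬ η(τ, γ) φ(τ, γ) dτ dγ`. -/
abbrev SpreadingFunction {Ω : Type*} [MeasurableSpace Ω] (P : Measure Ω) : Type _ :=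
  SmoothFn →ₗ[ℂ] Lp ℂ 2 P

/-- `η` is the spreading function of a WSSUS target with scattering function `C`
(a compactly supported integrable function): `η` has mean zero and
`E[conj η(τ, γ) η(τ', γ')] = δ(τ - τ') δ(γ - γ') C(τ, γ)` in the sense of distributions. -/
structure IsScatteringFunction {Ω : Type*} [MeasurableSpace Ω] {P : Measure Ω}
    (η : SpreadingFunction P) (C : ℝ × ℝ → ℝ) : Prop where
  integrable : Integrable C
  hasCompactSupport : HasCompactSupport C
  mean_zero : ∀ φ : SmoothFn, ∫ w, η φ w ∂P = 0
  wssus : ∀ φ ψ : SmoothFn,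
    correlation (η φ) (η ψ) = ∫ p : ℝ × ℝ, conj (φ.1 p) * ψ.1 p * (C p : ℂ)

/-- The weighted delta train `∑ k, c k δ_{kT}`, as a functional on test functions. -/
def deltaTrain (c : ℤ → ℂ) (T : ℝ) : (ℝ → ℂ) → ℂ :=
  fun φ => ∑' k : ℤ, c k * φ (k * T)

/-- The time shift `T_τ x(t) = x(t - τ)` of a distribution `x`. -/
def timeShift (τ : ℝ) (x : (ℝ → ℂ) → ℂ) : (ℝ → ℂ) → ℂ :=
  fun φ => x (fun t => φ (t + τ))

/-- The frequency shift `M_γ x(t) = e^{2π i γ t} x(t)` of a distribution `x`. -/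
def freqShift (γ : ℝ) (x : (ℝ → ℂ) → ℂ) : (ℝ → ℂ) → ℂ :=
  fun φ => x (fun t => expi (γ * t) * φ t)

/-- The function `(τ, γ) ↦ ⟨M_γ T_τ x, φ⟩`. -/
def echoKernel (x : (ℝ → ℂ) → ℂ) (φ : ℝ → ℂ) : ℝ × ℝ → ℂ :=
  fun p => freqShift p.2 (timeShift p.1 x) φ

/-- For a delta train and a test function the echo kernel is smooth. -/
theorem contDiff_echoKernel_deltaTrain (c : ℤ → ℂ) {T : ℝ} (hT : 0 < T) {φ : ℝ → ℂ}
    (hφ : IsTestFunction φ) : ContDiff ℝ ∞ (echoKernel (deltaTrain c T) φ) := by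
  obtain ⟨hs, hc⟩ := hφ
  obtain ⟨R, hR⟩ := hc.isCompact.isBounded.subset_closedBall 0
  have hz : ∀ t : ℝ, R < |t| → φ t = 0 := by
    intro t ht
    by_contra h
    have := hR (subset_tsupport φ h)
    simp [Metric.mem_closedBall] at this
    linarith
  rw [contDiff_iff_contDiffAt]
  intro p
  obtain ⟨N, hN⟩ := exists_nat_gt ((R + |p.1| + 1) / T)
  have hN' : R + |p.1| + 1 < N * T := by rwa [div_lt_iff₀ hT] at hN
  have hsm : ContDiff ℝ ∞ (fun q : ℝ × ℝ => ∑ k ∈ Finset.Icc (-(N : ℤ)) N,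
      c k * (expi (q.2 * (k * T + q.1)) * φ (k * T + q.1))) := by
    refine ContDiff.sum fun k _ => ?_
    refine contDiff_const.mul (ContDiff.mul ?_ (hs.comp (by fun_prop)))
    unfold expi
    refine ContDiff.cexp (contDiff_const.mul ?_)
    exact Complex.ofRealCLM.contDiff.comp
      (contDiff_snd.mul (contDiff_const.add contDiff_fst))
  refine hsm.contDiffAt.congr_of_eventuallyEq ?_
  have hnear : ∀ᶠ q : ℝ × ℝ in 𝓝 p, |q.1| < |p.1| + 1 := by
    have : ContinuousAt (fun q : ℝ × ℝ => |q.1|) p := by fun_prop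
    exact this.eventually (gt_mem_nhds (by linarith))
  filter_upwards [hnear] with q hq
  simp only [echoKernel, freqShift, timeShift, deltaTrain]
  refine tsum_eq_sum fun k hk => ?_
  have hk' : (N : ℝ) ≤ |(k : ℝ)| := by
    have h1 : (N : ℤ) ≤ |k| := by
      simp only [Finset.mem_Icc, not_and_or, not_le] at hk
      rcases hk with h | h
      · exact le_trans (by omega) (neg_le_abs k)
      · exact le_trans h.le (le_abs_self k)
    exact_mod_cast h1
  have h2 : R < |(k : ℝ) * T + q.1| := by
    have h3 : |(k : ℝ) * T| - |q.1| ≤ |(k : ℝ) * T + q.1| := by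
      have := abs_sub_abs_le_abs_sub ((k : ℝ) * T) (-q.1)
      simpa using this
    rw [abs_mul, abs_of_pos hT] at h3
    have := mul_le_mul_of_nonneg_right hk' hT.le
    linarith
  rw [hz _ h2]
  simp

open Classical in
/-- The echo `y = Hx = ∬ η(τ, γ) M_γ T_τ x dτ dγ`, as a generalized process on the time line:
`echo η x φ` stands for `∫ y(t) φ(t) dt`. The second case does not occur for the delta trains
and test functions used below (`contDiff_echoKernel_deltaTrain`). -/
def echo {Ω : Type*} [MeasurableSpace Ω] {P : Measure Ω} (η : SpreadingFunction P)
    (x : (ℝ → ℂ) → ℂ) (φ : ℝ → ℂ) : Lp ℂ 2 P :=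
  if h : ContDiff ℝ ∞ (echoKernel x φ) then η ⟨echoKernel x φ, h⟩ else 0

/-- Two generalized processes on the time line have the same autocorrelation
`E[conj y(t) y(s)]`. -/
def SameAutocorrelation {Ω₁ Ω₂ : Type*} [MeasurableSpace Ω₁] [MeasurableSpace Ω₂]
    {P₁ : Measure Ω₁} {P₂ : Measure Ω₂} (y₁ : (ℝ → ℂ) → Lp ℂ 2 P₁) (y₂ : (ℝ → ℂ) → Lp ℂ 2 P₂) :
    Prop :=
  ∀ φ ψ : ℝ → ℂ, IsTestFunction φ → IsTestFunction ψ →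
    correlation (y₁ φ) (y₁ ψ) = correlation (y₂ φ) (y₂ ψ)

/-- `E[conj y(t + nT) y(s)] = Π n t · δ(t - s)` on `0 < t, s < T`, for every integer `n`,
in the sense of distributions, with locally defined integrable functions `Π n`. -/
def IsEchoAutocorrelation {Ω : Type*} [MeasurableSpace Ω] {P : Measure Ω}
    (y : (ℝ → ℂ) → Lp ℂ 2 P) (T : ℝ) (Pi : ℤ → ℝ → ℂ) : Prop :=
  ∀ n : ℤ, IntegrableOn (Pi n) (Set.Ioo 0 T) ∧
    ∀ φ ψ : ℝ → ℂ, IsTestFunction φ → IsTestFunction ψ →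
      tsupport φ ⊆ Set.Ioo 0 T → tsupport ψ ⊆ Set.Ioo 0 T →
      correlation (y (fun t => φ (t - n * T))) (y ψ) =
        ∫ t in Set.Ioo 0 T, Pi n t * conj (φ t) * ψ t

/-- The channel autocorrelation function `P_h(s, t) = ∫ e^{-2π i γ s} C(t, γ) dγ`. -/
def channelACF (C : ℝ × ℝ → ℝ) (s t : ℝ) : ℂ :=
  ∫ γ : ℝ, expi (-(γ * s)) * (C (t, γ) : ℂ)

/-- `Π_n(t) = ∑ k, conj c_{k+n} c_k P_h(nT, t - kT)`. -/
def echoACF (c : ℤ → ℂ) (T : ℝ) (C : ℝ × ℝ → ℝ) (n : ℤ) (t : ℝ) : ℂ :=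
  ∑' k : ℤ, conj (c (k + n)) * c k * channelACF C (n * T) (t - k * T)

/-- The prototype rectangle `R = [0, T) × [0, B)`. -/
def cell (T B : ℝ) : Set (ℝ × ℝ) := Set.Ico 0 T ×ˢ Set.Ico 0 B

/-- The union of the translates `R + (a_j T, b_j B)`. -/
def cellUnion (T B : ℝ) {J : ℕ} (a b : Fin J → ℤ) : Set (ℝ × ℝ) :=
  ⋃ j : Fin J, {p | (p.1 - a j * T, p.2 - b j * B) ∈ cell T B}

/-- The patch `C_j(t, γ) = χ_R(t, γ) C(t + a_j T, γ + b_j B)`. -/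
def patch (T B : ℝ) {J : ℕ} (a b : Fin J → ℤ) (C : ℝ × ℝ → ℝ) (j : Fin J) : ℝ × ℝ → ℂ :=
  (cell T B).indicator fun p => (C (p.1 + a j * T, p.2 + b j * B) : ℂ)

/-- The matrix with entries `e^{-2π i r b_j / J} conj c_{r - a_j} c_{-a_j}`. -/
def gaborMatrix (c : ℤ → ℂ) {J : ℕ} (a b : Fin J → ℤ) : Matrix (Fin J) (Fin J) ℂ :=
  Matrix.of fun r j =>
    expi (-((r : ℕ) * b j / J)) * conj (c ((r : ℕ) - a j)) * c (-a j)

/-- The summand `B⁻¹ e^{2π i γ T (mJ + r)} Π_{mJ + r}(t)`. -/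
def seriesTerm (T B : ℝ) {J : ℕ} (Pi : ℤ → ℝ → ℂ) (r : Fin J) (m : ℤ) (p : ℝ × ℝ) : ℂ :=
  (B : ℂ)⁻¹ * expi (p.2 * T * (m * J + (r : ℕ))) * Pi (m * J + (r : ℕ)) p.1

/-- The formula `C_j(t, γ) = ∑ r, V_{jr} B⁻¹ ∑ m, e^{2π i γ T (mJ + r)} Π_{mJ + r}(t)` on the
rectangle `(0, T) × (0, B)`, in the sense of distributions: both sides agree, and the series
converge, after integration against any test function supported there. -/
def WeakReconstruction (T B : ℝ) {J : ℕ} (V : Matrix (Fin J) (Fin J) ℂ) (Pi : ℤ → ℝ → ℂ)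
    (F : Fin J → ℝ × ℝ → ℂ) : Prop :=
  ∀ φ : ℝ × ℝ → ℂ, IsTestFunction φ → tsupport φ ⊆ Set.Ioo 0 T ×ˢ Set.Ioo 0 B →
    (∀ (r : Fin J) (m : ℤ), Integrable fun p => φ p * seriesTerm T B Pi r m p) ∧
    (∀ r : Fin J, Summable fun m : ℤ => ∫ p, φ p * seriesTerm T B Pi r m p) ∧
    ∀ j : Fin J, ∫ p, φ p * F j p =
      ∑ r : Fin J, V j r * ∑' m : ℤ, ∫ p, φ p * seriesTerm T B Pi r m p

/-- The same formula, with the series converging (unconditionally) in `L²` of the rectangle. -/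
def L2Reconstruction (T B : ℝ) {J : ℕ} (V : Matrix (Fin J) (Fin J) ℂ) (Pi : ℤ → ℝ → ℂ)
    (F : Fin J → ℝ × ℝ → ℂ) : Prop :=
  ∀ j : Fin J, Tendsto (fun s : Finset ℤ =>
    eLpNorm (fun p => F j p - ∑ r : Fin J, V j r * ∑ m ∈ s, seriesTerm T B Pi r m p) 2
      (volume.restrict (cell T B))) atTop (𝓝 0)

end

/-! The theorem rests on a geometric choice, an algebraic choice and Fourier series in Doppler.
Geometry (`exists_cover_isUnit_gaborMatrix`): since `S` is compact, some closed `δ`-neighbourhood of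
it still has area `m < 1`. With cells of width `T = δ` and height `B = 1 / (Jδ)`, at most `m * J` of
them meet `S`. For large `J` there is room to add a cell in every time column and to pad to exactly
`J` cells, in a number `L` of columns independent of `J`. Algebra (`exists_isUnit_gaborMatrix`):
take for `c` a truncated Gaussian `x ^ (-k²)`, periodized. Expanding `(r - α)² = r² - 2rα + α²`
turns the matrix, up to a cyclic shift of rows and nonzero row and column scalings, into a
Vandermonde matrix with nodes `e^{-2πi b_j/J} x ^ (2 α_j)`, in which the truncation has deleted some
entries. By the rearrangement inequality the top-degree coefficient of the determinant in `x` sees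
only the diagonal blocks of equal `α`. No entry there is deleted, so the determinant is a nonzero
polynomial and some `x > 0` works. Analysis: on `(0, T)` at most one delta contributes to each test
function at a given delay, so the WSSUS property gives the formula for `Π_n`. Cutting `C` into
patches and using `JTB = 1` and the periodicity of `c`, `Π_{mJ+r}(t)` becomes, up to the factor `B`,
the `m`-th Fourier coefficient on `[0, B)` of a modulated `∑ j, A_{rj} C_j(t, ·)`
(`echoACF_eq_integral_patchMix`). Fourier inversion, weak or in `L²`, followed by `A⁻¹` recovers the
patches. Identification follows because equal autocorrelations allow the same `Π_n` for both
targets. -/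

/-! ### Truncated Vandermonde determinants. -/

/-- The top coefficient of a Vandermonde determinant in monomials of increasing degree. -/
theorem coeff_det_vandermonde_monomial_ne_zero {n : ℕ} {e : Fin n → ℕ} (he : Monotone e)
    {w : Fin n → ℂ} (hw : ∀ j, w j ≠ 0) (hew : ∀ i j, i ≠ j → e i = e j → w i ≠ w j) :
    (Matrix.vandermonde fun j => Polynomial.C (w j) * Polynomial.X ^ e j).det.coeff
      (∑ r : Fin n, (r : ℕ) * e r) ≠ 0 := by
  classical
  have hcoeff : ∀ i j : Fin n, i < j →
      (Polynomial.C (w j) * Polynomial.X ^ e j - Polynomial.C (w i) * Polynomial.X ^ e i).coeff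
        (e j) ≠ 0 := by
    intro i j hij
    simp only [Polynomial.coeff_sub, Polynomial.coeff_C_mul, Polynomial.coeff_X_pow]
    by_cases h : e i = e j
    · simpa [h, sub_eq_zero] using (hew i j hij.ne h).symm
    · simpa [Ne.symm h] using hw j
  have hdeg : ∀ i j : Fin n, i < j →
      (Polynomial.C (w j) * Polynomial.X ^ e j - Polynomial.C (w i) * Polynomial.X ^ e i).natDegree
        = e j := by
    intro i j hij
    refine le_antisymm (Polynomial.natDegree_sub_le_of_le (Polynomial.natDegree_C_mul_X_pow_le _ _)
      ((Polynomial.natDegree_C_mul_X_pow_le _ _).trans (he hij.le)) |>.trans (max_self _).le)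
      (Polynomial.le_natDegree_of_ne_zero (hcoeff i j hij))
  have hne : ∀ i j : Fin n, i < j →
      Polynomial.C (w j) * Polynomial.X ^ e j - Polynomial.C (w i) * Polynomial.X ^ e i ≠ 0 := by
    intro i j hij h
    exact hcoeff i j hij (by rw [h]; simp)
  rw [Matrix.det_vandermonde]
  -- The factor for `i < j` has degree exactly `e j`, and `j` is the larger index in `j` factors.
  have hD : ∑ r : Fin n, (r : ℕ) * e r = (∏ i : Fin n, ∏ j ∈ Finset.Ioi i,
      (Polynomial.C (w j) * Polynomial.X ^ e j
        - Polynomial.C (w i) * Polynomial.X ^ e i)).natDegree := by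
    rw [Polynomial.natDegree_prod _ _ fun i _ => Finset.prod_ne_zero_iff.2 fun j hj =>
      hne i j (Finset.mem_Ioi.1 hj)]
    have : ∀ i : Fin n, (∏ j ∈ Finset.Ioi i, (Polynomial.C (w j) * Polynomial.X ^ e j
        - Polynomial.C (w i) * Polynomial.X ^ e i)).natDegree = ∑ j ∈ Finset.Ioi i, e j := by
      intro i
      rw [Polynomial.natDegree_prod _ _ fun j hj => hne i j (Finset.mem_Ioi.1 hj)]
      exact Finset.sum_congr rfl fun j hj => hdeg i j (Finset.mem_Ioi.1 hj)
    simp only [this]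
    rw [Finset.sum_comm' (t' := Finset.univ) (s' := fun j => Finset.Iio j) (by simp)]
    simp
  rw [hD, Polynomial.coeff_natDegree, Polynomial.leadingCoeff_ne_zero]
  exact Finset.prod_ne_zero_iff.2 fun i _ => Finset.prod_ne_zero_iff.2 fun j hj =>
    hne i j (Finset.mem_Ioi.1 hj)

/-- A Vandermonde matrix with nodes `w j * x ^ e j` stays invertible for some `x > 0` when entries
that do not meet the dominant diagonal blocks are deleted. -/
theorem exists_det_truncated_vandermonde_ne_zero {n : ℕ} {e : Fin n → ℕ} (he : Monotone e)
    {w : Fin n → ℂ} (hw : ∀ j, w j ≠ 0) (hew : ∀ i j, i ≠ j → e i = e j → w i ≠ w j)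
    (Q : Fin n → Fin n → Prop) [∀ j r, Decidable (Q j r)] (hQ : ∀ j r, e j = e r → Q j r) :
    ∃ x : ℝ, 0 < x ∧
      (Matrix.of fun j r : Fin n => if Q j r then (w j * (x : ℂ) ^ e j) ^ (r : ℕ) else 0).det
        ≠ 0 := by
  classical
  set N : Matrix (Fin n) (Fin n) (Polynomial ℂ) := Matrix.of fun j r : Fin n =>
    if Q j r then (Polynomial.C (w j) * Polynomial.X ^ e j) ^ (r : ℕ) else 0 with hN
  have hcoef : N.det.coeff (∑ r : Fin n, (r : ℕ) * e r) =
      (Matrix.vandermonde fun j => Polynomial.C (w j) * Polynomial.X ^ e j).det.coeff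
      (∑ r : Fin n, (r : ℕ) * e r) := by
    rw [Matrix.det_apply, Matrix.det_apply, Polynomial.finsetSum_coeff, Polynomial.finsetSum_coeff]
    refine Finset.sum_congr rfl fun σ _ => ?_
    rw [Polynomial.coeff_smul, Polynomial.coeff_smul]
    congr 1
    by_cases hσ : ∀ r, Q (σ r) r
    · simp [hN, Matrix.vandermonde_apply, hσ]
    · push Not at hσ
      obtain ⟨r, hr⟩ := hσ
      rw [Finset.prod_eq_zero (Finset.mem_univ r) (by simp [hN, hr])]
      have h1 : ∏ i, Matrix.vandermonde (fun j => Polynomial.C (w j) * Polynomial.X ^ e j) (σ i) i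
          = Polynomial.C (∏ i, w (σ i) ^ (i : ℕ)) *
            Polynomial.X ^ (∑ i : Fin n, (i : ℕ) * e (σ i)) := by
        simp only [Matrix.vandermonde_apply, mul_pow, Finset.prod_mul_distrib, map_prod, map_pow,
          ← pow_mul, Finset.prod_pow_eq_pow_sum, mul_comm]
      rw [h1, Polynomial.coeff_C_mul, Polynomial.coeff_X_pow, if_neg]
      · simp
      · intro h
        -- Equality case of the rearrangement inequality: a permutation reaching the top degree
        -- satisfies `e ∘ σ = e`, so by `hQ` it meets no deleted entry, contrary to `hr`.
        have hm : Monovary (fun i : Fin n => (i : ℕ)) e := by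
          intro i j hij
          by_contra hlt
          exact absurd (he (show j ≤ i from le_of_lt (by simpa using hlt))) (not_le.2 hij)
        have h2 := (hm.sum_mul_comp_perm_eq_sum_mul_iff (σ := σ)).1 h.symm
        have h3 : Monotone (e ∘ σ) := by
          intro i j hij
          by_contra hlt
          rw [not_le] at hlt
          have := h2 hlt
          have h4 : i = j := le_antisymm hij (by simpa using this)
          subst h4
          exact lt_irrefl _ hlt
        have h5 : e ∘ σ = e ∘ (1 : Equiv.Perm (Fin n)) :=
          Tuple.unique_monotone h3 (by simpa using he)
        exact hr (hQ _ _ (congrFun h5 r))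
  have hne : N.det ≠ 0 := by
    intro h
    rw [h] at hcoef
    exact coeff_det_vandermonde_monomial_ne_zero he hw hew (by rw [← hcoef]; simp)
  have hex : ∃ x : ℝ, 0 < x ∧ N.det.eval (x : ℂ) ≠ 0 := by
    by_contra! hall
    refine hne (Polynomial.eq_zero_of_infinite_isRoot _ ?_)
    refine Set.Infinite.mono (s := (fun x : ℝ => (x : ℂ)) '' Set.Ioi 0) ?_ ?_
    · rintro _ ⟨x, hx, rfl⟩
      exact hall x hx
    · exact (Set.Ioi_infinite 0).image Complex.ofReal_injective.injOn
  obtain ⟨x, hx, hdet⟩ := hex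
  refine ⟨x, hx, ?_⟩
  rw [← Polynomial.coe_evalRingHom, RingHom.map_det] at hdet
  convert hdet using 2
  ext j r
  simp only [hN, Matrix.of_apply, RingHom.mapMatrix_apply, Matrix.map_apply]
  split_ifs <;> simp

/-! ### The complex exponential. -/

theorem expi_add (x y : ℝ) : expi (x + y) = expi x * expi y := by
  simp only [expi, ← Complex.exp_add]
  congr 1
  push_cast
  ring

theorem expi_zero : expi 0 = 1 := by simp [expi]

theorem expi_ne_zero (x : ℝ) : expi x ≠ 0 := Complex.exp_ne_zero _

theorem expi_int (k : ℤ) : expi k = 1 := by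
  rw [expi, Complex.exp_eq_one_iff]
  exact ⟨k, by push_cast; ring⟩

theorem expi_nat_mul (n : ℕ) (x : ℝ) : expi (n * x) = expi x ^ n := by
  simp only [expi, ← Complex.exp_nat_mul]
  congr 1
  push_cast
  ring

theorem norm_expi (x : ℝ) : ‖expi x‖ = 1 := by
  have : expi x = Complex.exp ((2 * Real.pi * x : ℝ) * Complex.I) := by
    rw [expi]; congr 1; push_cast; ring
  rw [this, Complex.norm_exp_ofReal_mul_I]

theorem conj_expi (x : ℝ) : conj (expi x) = expi (-x) := by
  rw [expi, expi, ← Complex.exp_conj]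
  congr 1
  simp [Complex.conj_ofNat]

theorem expi_eq_expi_iff {x y : ℝ} : expi x = expi y ↔ ∃ k : ℤ, x = y + k := by
  rw [expi, expi, Complex.exp_eq_exp_iff_exists_int]
  refine exists_congr fun k => ?_
  have h2 : (2 * Real.pi * Complex.I : ℂ) ≠ 0 := by simp [Real.pi_ne_zero]
  rw [show (2 * Real.pi * Complex.I * y + k * (2 * Real.pi * Complex.I) : ℂ)
    = 2 * Real.pi * Complex.I * (y + k) by ring, mul_right_inj' h2]
  exact_mod_cast Iff.rfl

theorem contDiff_expi : ContDiff ℝ ∞ expi := by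
  unfold expi
  exact ContDiff.cexp (contDiff_const.mul Complex.ofRealCLM.contDiff)

@[fun_prop]
theorem continuous_expi : Continuous expi := contDiff_expi.continuous

/-! ### A sounding sequence with invertible matrix. -/

/-- A monotone sequence of length `J` taking exactly the values `0, …, L - 1` stays close to the
diagonal. -/
theorem monotone_surjective_bounds {J L : ℕ} {α : Fin J → ℕ} (hmono : Monotone α)
    (hL : ∀ j, α j < L) (hsurj : ∀ l < L, ∃ j, α j = l) (r : Fin J) :
    α r ≤ r ∧ (r : ℕ) + L ≤ J + α r := by
  constructor
  -- Each of the values below `α r` is attained, necessarily at an index below `r`; the second bound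
  -- is the mirror image.
  · have h : Finset.range (α r) ⊆ (Finset.Iio r).image α := by
      intro l hl
      rw [Finset.mem_range] at hl
      obtain ⟨j, rfl⟩ := hsurj l (hl.trans (hL r))
      exact Finset.mem_image_of_mem _ (Finset.mem_Iio.2 (hmono.reflect_lt hl))
    simpa using (Finset.card_le_card h).trans Finset.card_image_le
  · have h : Finset.Ioo (α r) L ⊆ (Finset.Ioi r).image α := by
      intro l hl
      rw [Finset.mem_Ioo] at hl
      obtain ⟨j, rfl⟩ := hsurj l hl.2
      exact Finset.mem_image_of_mem _ (Finset.mem_Ioi.2 (hmono.reflect_lt hl.1))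
    have := (Finset.card_le_card h).trans Finset.card_image_le
    simp only [Nat.card_Ioo, Fin.card_Ioi] at this
    have := hL r
    have := r.2
    omega

/-- Time-frequency shifts of a suitable window, with few time shifts all of which occur, form an
invertible matrix. -/
theorem exists_isUnit_gaborMatrix {J L : ℕ} (hLJ : 2 * L ≤ J + 1) (A : ℤ) (a b : Fin J → ℤ)
    (hmono : Monotone a) (hlo : ∀ j, A ≤ a j) (hhi : ∀ j, a j < A + L)
    (hsurj : ∀ l : ℤ, A ≤ l → l < A + L → ∃ j, a j = l)
    (hinj : ∀ i j, a i = a j → (J : ℤ) ∣ b i - b j → i = j) :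
    ∃ c : ℤ → ℂ, Function.Periodic c (J : ℤ) ∧ IsUnit (gaborMatrix c a b) := by
  classical
  rcases Nat.eq_zero_or_pos J with rfl | hJ
  · exact ⟨0, fun _ => rfl, by rw [Subsingleton.elim (gaborMatrix 0 a b) 1]; exact isUnit_one⟩
  have hJ' : (J : ℝ) ≠ 0 := by positivity
  set α : Fin J → ℕ := fun j => (a j - A).toNat with hα
  have ha : ∀ j, a j = A + α j := fun j => by
    have := hlo j
    simp only [hα]; omega
  have hαL : ∀ j, α j < L := fun j => by
    have := ha j; have := hhi j; omega
  have hαm : Monotone α := fun i j hij => by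
    have := hmono hij; have := ha i; have := ha j; omega
  have hαs : ∀ l < L, ∃ j, α j = l := fun l hl => by
    obtain ⟨j, hj⟩ := hsurj (A + l) (by omega) (by omega)
    exact ⟨j, by have := ha j; omega⟩
  have hQ : ∀ j r : Fin J, 2 * α j = 2 * α r → (α j ≤ r ∧ (r : ℕ) + L ≤ J + α j) := by
    intro j r h
    rw [show α j = α r by omega]
    exact monotone_surjective_bounds hαm hαL hαs r
  obtain ⟨x, hx, hdet⟩ := exists_det_truncated_vandermonde_ne_zero (e := fun j => 2 * α j)
    (fun i j hij => Nat.mul_le_mul_left 2 (hαm hij)) (w := fun j => expi (-(b j / J)))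
    (fun j => expi_ne_zero _) (by
      intro i j hij h hw
      obtain ⟨k, hk⟩ := expi_eq_expi_iff.1 hw
      refine hij (hinj i j (by rw [ha, ha, show α i = α j by simpa using h]) ⟨-k, ?_⟩)
      field_simp at hk
      have : (b i - b j : ℝ) = J * (-k) := by linarith
      exact_mod_cast this)
    (fun j r => α j ≤ r ∧ (r : ℕ) + L ≤ J + α j) hQ
  have hx' : (x : ℂ) ≠ 0 := by exact_mod_cast hx.ne'
  -- A Gaussian cut off so that the last `L - 1` residues of a period vanish: time shifts by fewer
  -- than `L` steps then wrap around only into zeros.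
  set d : ℤ → ℂ := fun m => if m + L ≤ J then (x : ℂ) ^ (-(m ^ 2)) else 0 with hd
  -- The offset makes `c (-a j)` equal to `d (L - 1 - α j)`, which lies in the nonzero part of `d`
  -- because `2 * L ≤ J + 1`.
  set c : ℤ → ℂ := fun k => d ((k + A + L - 1) % J) with hc
  have hper : Function.Periodic c (J : ℤ) := by
    intro k
    simp only [hc]
    congr 1
    rw [show k + J + A + L - 1 = k + A + L - 1 + J by ring, Int.add_emod_right]
  have hconj : ∀ k, conj (c k) = c k := by
    intro k
    simp only [hc, hd]
    split_ifs
    · rw [map_zpow₀, Complex.conj_ofReal]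
    · simp
  have hc0 : ∀ j, c (-a j) ≠ 0 := by
    intro j
    have := hαL j
    have h1 : (-a j + A + L - 1) % J = (L : ℤ) - 1 - α j := by
      rw [ha j, show (-(A + α j) + A + L - 1 : ℤ) = (L : ℤ) - 1 - α j by ring]
      exact Int.emod_eq_of_lt (by omega) (by omega)
    simp only [hc, hd, h1]
    rw [if_pos (by omega)]
    exact zpow_ne_zero _ hx'
  have hcr : ∀ j r : Fin J, c ((r : ℕ) - (L - 1) - a j) =
      if α j ≤ r ∧ (r : ℕ) + L ≤ J + α j then (x : ℂ) ^ (-(((r : ℕ) - α j : ℤ) ^ 2)) else 0 := by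
    intro j r
    have h1 := hαL j
    have h2 := r.2
    simp only [hc, hd]
    rw [ha j, show ((r : ℕ) - (L - 1) - (A + α j) + A + L - 1 : ℤ) = (r : ℕ) - α j by ring]
    by_cases h : α j ≤ r
    · rw [Int.emod_eq_of_lt (by omega) (by omega)]
      refine if_congr ?_ rfl rfl
      omega
    -- Here `r - α j` wraps to `r - α j + J`, which is in the zero block since `α j < L`.
    · rw [← Int.add_emod_right, Int.emod_eq_of_lt (by omega) (by omega), if_neg (by omega),
        if_neg fun hh => h hh.1]
  clear_value c
  refine ⟨c, hper, ?_⟩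
  rw [Matrix.isUnit_iff_isUnit_det, isUnit_iff_ne_zero]
  intro h0
  obtain ⟨v, hv, hAv⟩ := Matrix.exists_mulVec_eq_zero_iff.2 h0
  -- The row relations extend periodically to all integers `k`, so they may be read at `r - (L -
  -- 1)`, where the window is a plain Gaussian in `r - α j`.
  set G : ℤ → ℂ := fun k => ∑ j, expi (-(k * b j / J)) * c (k - a j) * c (-a j) * v j with hG
  have hGper : Function.Periodic G (J : ℤ) := by
    intro k
    simp only [hG]
    refine Finset.sum_congr rfl fun j _ => ?_
    rw [show k + (J : ℤ) - a j = k - a j + J by ring, hper]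
    congr 3
    rw [show (-(((k + J : ℤ) : ℝ) * b j / J)) = -(k * b j / J) + ((-b j : ℤ) : ℝ) by
      push_cast; field_simp; ring, expi_add, expi_int, mul_one]
  have hG0 : ∀ k, G k = 0 := by
    intro k
    have h1 : G k = G (k % J) := by
      have := hGper.sub_zsmul_eq (x := k) (k / J)
      rw [← this]
      congr 1
      have := Int.emod_add_mul_ediv k J
      rw [smul_eq_mul]; linarith
    rw [h1]
    have h2 : (k % J).toNat < J := by
      have := Int.emod_lt_of_pos k (show (0 : ℤ) < J by exact_mod_cast hJ)
      omega
    have h3 := congrFun hAv ⟨(k % J).toNat, h2⟩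
    have h4 : (((k % J).toNat : ℕ) : ℤ) = k % J :=
      Int.toNat_of_nonneg (Int.emod_nonneg _ (by omega))
    have h4' : (((k % J).toNat : ℕ) : ℝ) = ((k % J : ℤ) : ℝ) := by
      exact_mod_cast congrArg (Int.cast : ℤ → ℝ) h4
    simpa [Matrix.mulVec, dotProduct, gaborMatrix, hconj, h4, h4', hG] using h3
  -- The kernel vector with the column factors absorbed; the row factor `x ^ (-r²)` is cancelled
  -- below by multiplying with `x ^ r²`.
  set u : Fin J → ℂ := fun j =>
    expi ((L - 1) * b j / J) * (x : ℂ) ^ (-((α j : ℤ) ^ 2)) * c (-a j) * v j with hu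
  have hu0 : u = 0 := by
    refine Matrix.eq_zero_of_vecMul_eq_zero hdet ?_
    ext r
    have h1 := hG0 ((r : ℕ) - (L - 1))
    have h2 : (x : ℂ) ^ ((r : ℕ) ^ 2) * G ((r : ℕ) - (L - 1)) = 0 := by rw [h1, mul_zero]
    refine Eq.trans ?_ h2
    simp only [Matrix.vecMul, dotProduct, Matrix.of_apply, hG, Finset.mul_sum]
    refine Finset.sum_congr rfl fun j _ => ?_
    rw [hcr j r]
    split_ifs with hq
    · have e1 : expi (-((((r : ℕ) - (L - 1) : ℤ) : ℝ) * b j / J)) =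
          expi ((L - 1) * b j / J) * expi (-(b j / J)) ^ (r : ℕ) := by
        rw [← expi_nat_mul, ← expi_add]
        congr 1
        push_cast
        field_simp
        ring
      have e2 : (x : ℂ) ^ ((r : ℕ) ^ 2) * (x : ℂ) ^ (-(((r : ℕ) - α j : ℤ) ^ 2)) =
          (x : ℂ) ^ (-((α j : ℤ) ^ 2)) * ((x : ℂ) ^ (2 * α j)) ^ (r : ℕ) := by
        rw [← pow_mul, ← zpow_natCast, ← zpow_natCast, ← zpow_add₀ hx', ← zpow_add₀ hx']
        congr 1
        push_cast
        ring
      rw [e1, mul_pow, hu]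
      linear_combination (-expi ((L - 1) * b j / J) * expi (-(b j / J)) ^ (r : ℕ)
        * c (-a j) * v j) * e2
    · simp
  refine hv (funext fun j => ?_)
  have h := congrFun hu0 j
  simp only [hu, Pi.zero_apply, mul_eq_zero, expi_ne_zero, hc0, zpow_ne_zero _ hx',
    false_or] at h
  simpa using h

/-! ### Covering `S` by cells. -/

/-- A point lies in exactly one translate of the prototype rectangle. -/
theorem mem_cell_translate_iff {T B : ℝ} (hT : 0 < T) (hB : 0 < B) (p : ℝ × ℝ) (m n : ℤ) :
    (p.1 - m * T, p.2 - n * B) ∈ cell T B ↔ m = ⌊p.1 / T⌋ ∧ n = ⌊p.2 / B⌋ := by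
  have key : ∀ {x D : ℝ} (_ : 0 < D) (k : ℤ), x - k * D ∈ Set.Ico 0 D ↔ k = ⌊x / D⌋ := by
    intro x D hD k
    rw [eq_comm, Int.floor_eq_iff, le_div_iff₀ hD, div_lt_iff₀ hD, Set.mem_Ico]
    constructor <;> rintro ⟨h1, h2⟩ <;> constructor <;> linarith
  rw [cell, Set.mem_prod, key hT, key hB]

theorem volume_cell_translate {T B : ℝ} (hT : 0 < T) (m n : ℤ) :
    volume {p : ℝ × ℝ | (p.1 - m * T, p.2 - n * B) ∈ cell T B} = ENNReal.ofReal (T * B) := by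
  have : {p : ℝ × ℝ | (p.1 - m * T, p.2 - n * B) ∈ cell T B} =
      Set.Ico (m * T) (m * T + T) ×ˢ Set.Ico (n * B) (n * B + B) := by
    ext p
    simp only [cell, Set.mem_ofPred_eq, Set.mem_prod, Set.mem_Ico]
    constructor <;> rintro ⟨⟨h1, h2⟩, h3, h4⟩ <;> refine ⟨⟨?_, ?_⟩, ?_, ?_⟩ <;> linarith
  rw [this, Measure.volume_eq_prod, Measure.prod_prod, Real.volume_Ico, Real.volume_Ico,
    ← ENNReal.ofReal_mul (by linarith)]
  congr 1
  ring

theorem measurableSet_cell_translate {T B : ℝ} (m n : ℤ) :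
    MeasurableSet {p : ℝ × ℝ | (p.1 - m * T, p.2 - n * B) ∈ cell T B} := by
  have h : MeasurableSet (cell T B) := measurableSet_Ico.prod measurableSet_Ico
  exact (by fun_prop : Measurable fun p : ℝ × ℝ => (p.1 - m * T, p.2 - n * B)) h

/-- The number of small cells that meet `S` is controlled by the area of a thickening of `S`. -/
theorem card_mul_le_volume_cthickening {T B δ : ℝ} (hT : 0 < T) (hB : 0 < B) (hTδ : T ≤ δ)
    (hBδ : B ≤ δ) {S : Set (ℝ × ℝ)} (K : Finset (ℤ × ℤ))
    (hK : ∀ k ∈ K, ∃ p ∈ S, (p.1 - k.1 * T, p.2 - k.2 * B) ∈ cell T B) :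
    (K.card : ℝ≥0∞) * ENNReal.ofReal (T * B) ≤ volume (Metric.cthickening δ S) := by
  have h1 : volume (⋃ k ∈ K, {p : ℝ × ℝ | (p.1 - k.1 * T, p.2 - k.2 * B) ∈ cell T B})
      = K.card * ENNReal.ofReal (T * B) := by
    rw [measure_biUnion_finset]
    · simp [volume_cell_translate hT]
    · intro k _ l _ hkl
      refine Set.disjoint_left.2 fun p hp hq => hkl ?_
      rw [Set.mem_ofPred_eq, mem_cell_translate_iff hT hB] at hp hq
      exact Prod.ext (hp.1.trans hq.1.symm) (hp.2.trans hq.2.symm)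
    · exact fun k _ => measurableSet_cell_translate _ _
  rw [← h1]
  refine measure_mono (Set.iUnion₂_subset fun k hk p hp => ?_)
  obtain ⟨q, hq, hqk⟩ := hK k hk
  refine Metric.mem_cthickening_of_dist_le p q δ S hq ?_
  simp only [cell, Set.mem_ofPred_eq, Set.mem_prod, Set.mem_Ico] at hp hqk
  rw [Prod.dist_eq, Real.dist_eq, Real.dist_eq]
  refine max_le (abs_le.2 ⟨?_, ?_⟩) (abs_le.2 ⟨?_, ?_⟩) <;> linarith

/-- Enumeration of a finite set of pairs with monotone first component. -/
theorem exists_enumeration_monotone_fst (K : Finset (ℤ × ℤ)) {J : ℕ} (hK : K.card = J) :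
    ∃ a b : Fin J → ℤ, Monotone a ∧ (Function.Injective fun j => (a j, b j)) ∧
      ∀ k, k ∈ K ↔ ∃ j, k = (a j, b j) := by
  let e := K.equivFinOfCardEq hK
  let σ := Tuple.sort fun j => ((e.symm j : ℤ × ℤ)).1
  refine ⟨fun j => (e.symm (σ j) : ℤ × ℤ).1, fun j => (e.symm (σ j) : ℤ × ℤ).2,
    Tuple.monotone_sort fun j => ((e.symm j : ℤ × ℤ)).1, fun i j hij => ?_, fun k => ⟨fun hk => ?_, ?_⟩⟩
  · exact σ.injective (e.symm.injective (Subtype.ext hij))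
  · exact ⟨σ.symm (e ⟨k, hk⟩), by simp⟩
  · rintro ⟨j, rfl⟩
    exact (e.symm (σ j)).2

/-- A compact set of area less than one is covered by `J` cells of area `1 / J`, for which some
sounding sequence has an invertible matrix. -/
theorem exists_cover_isUnit_gaborMatrix {S : Set (ℝ × ℝ)} (hS : IsCompact S) (hM : volume S < 1) :
    ∃ (T B : ℝ) (J : ℕ) (c : ℤ → ℂ) (a b : Fin J → ℤ),
      0 < T ∧ 0 < B ∧ J.Prime ∧ J * T * B = 1 ∧ Function.Periodic c (J : ℤ) ∧
      S ⊆ cellUnion T B a b ∧ IsUnit (gaborMatrix c a b) ∧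
      Function.Injective fun j => (a j, b j) := by
  classical
  obtain ⟨W, hW0, hW⟩ := hS.isBounded.subset_closedBall_lt 0 0
  have hWS : ∀ p ∈ S, |p.1| ≤ W ∧ |p.2| ≤ W := by
    intro p hp
    simpa [Prod.norm_def] using hW hp
  obtain ⟨δ, hδ0, hδvol, hδW⟩ : ∃ δ : ℝ, 0 < δ ∧ volume (Metric.cthickening δ S) < 1 ∧
      4 * W * δ ≤ 1 := by
    have h1 := (tendsto_measure_cthickening_of_isCompact (μ := volume) hS).eventually
      (gt_mem_nhds hM)
    have h2 : ∀ᶠ δ : ℝ in 𝓝 0, 4 * W * δ < 1 := by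
      have : ContinuousAt (fun δ : ℝ => 4 * W * δ) 0 := by fun_prop
      exact this.eventually (gt_mem_nhds (by norm_num))
    obtain ⟨δ, h, hδ⟩ := ((h1.and h2).filter_mono nhdsWithin_le_nhds |>.and
      (self_mem_nhdsWithin (s := Set.Ioi (0 : ℝ)))).exists
    exact ⟨δ, hδ, h.1, h.2.le⟩
  set m : ℝ := (volume (Metric.cthickening δ S)).toReal with hm
  have hm1 : m < 1 := by
    have := (ENNReal.toReal_lt_toReal hδvol.ne_top ENNReal.one_ne_top).2 hδvol
    simpa using this
  set g : ℕ := ⌈W / δ⌉₊ with hg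
  set L : ℕ := 2 * g + 1 with hL
  -- Any large `J` would do for the construction. The summands give respectively `2 * h + 1 ≤ J`
  -- (together with `4Wδ ≤ 1`), room for the window, `B ≤ δ`, and `L + m * J ≤ J`.
  obtain ⟨J, hJ, hJp⟩ := Nat.exists_infinite_primes
    (6 + 2 * L + ⌈1 / δ ^ 2⌉₊ + ⌈L / (1 - m)⌉₊)
  have hJ6 : 6 ≤ J := by omega
  have hJL : 2 * L ≤ J := by omega
  have hJR : (0 : ℝ) < J := by exact_mod_cast hJp.pos
  have hJδ : 1 / δ ^ 2 ≤ J := (Nat.le_ceil _).trans (by exact_mod_cast (by omega))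
  have hJm : L + m * J ≤ J := by
    have h1 : (L : ℝ) / (1 - m) ≤ J := (Nat.le_ceil _).trans (by exact_mod_cast (by omega))
    rw [div_le_iff₀ (by linarith)] at h1
    linarith
  set B : ℝ := 1 / (J * δ) with hB
  have hB0 : 0 < B := by positivity
  have hTB : J * δ * B = 1 := by rw [hB]; field_simp
  have hBδ : B ≤ δ := by
    rw [div_le_iff₀ (by positivity)] at hJδ
    rw [hB, div_le_iff₀ (by positivity)]
    linarith
  set h : ℕ := ⌈W / B⌉₊ with hh
  have hhJ : 2 * h + 1 ≤ J := by
    have h1 : W / B = W * δ * J := by rw [hB]; field_simp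
    have h2 : (h : ℝ) < W / B + 1 := Nat.ceil_lt_add_one (by positivity)
    have h3 : 4 * W * δ * J ≤ 1 * J := mul_le_mul_of_nonneg_right hδW hJR.le
    have h4 : (4 * h : ℝ) < J + 4 := by linarith
    have h5 : 4 * h < J + 4 := by exact_mod_cast h4
    omega
  have hfloor : ∀ {x D : ℝ} (_ : 0 < D), |x| ≤ W →
      -(⌈W / D⌉₊ : ℤ) ≤ ⌊x / D⌋ ∧ ⌊x / D⌋ ≤ ⌈W / D⌉₊ := by
    intro x D hD hx
    have hc := Nat.le_ceil (W / D)
    have hx' := abs_le.1 hx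
    constructor
    · rw [Int.le_floor]
      have : -(W / D) ≤ x / D := by rw [← neg_div]; gcongr; exact hx'.1
      push_cast; linarith
    · have h1 : (⌊x / D⌋ : ℝ) ≤ ⌈W / D⌉₊ :=
        (Int.floor_le _).trans ((by gcongr; exact hx'.2 : x / D ≤ W / D).trans hc)
      exact_mod_cast h1
  set X : Finset (ℤ × ℤ) := Finset.Ico (-(g : ℤ)) (-g + L) ×ˢ Finset.Ico (-(h : ℤ)) (-h + J) with hX
  set K : Finset (ℤ × ℤ) := X.filter fun k => ∃ p ∈ S, (p.1 - k.1 * δ, p.2 - k.2 * B) ∈ cell δ B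
    with hK
  -- One cell in each time column, so that every time shift occurs, as the truncated Vandermonde
  -- argument needs.
  set Z : Finset (ℤ × ℤ) := Finset.Ico (-(g : ℤ)) (-g + L) ×ˢ {0} with hZ
  have hKcard : (K.card : ℝ) ≤ m * J := by
    have h1 := card_mul_le_volume_cthickening hδ0 hB0 le_rfl hBδ K
      fun k hk => (Finset.mem_filter.1 hk).2
    have h2 := (ENNReal.toReal_le_toReal (by finiteness) hδvol.ne_top).2 h1
    rw [ENNReal.toReal_mul, ENNReal.toReal_natCast, ENNReal.toReal_ofReal (by positivity),
      ← hm] at h2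
    have h3 := mul_le_mul_of_nonneg_right h2 hJR.le
    calc (K.card : ℝ) = K.card * (δ * B) * J := by
          rw [mul_assoc, show δ * B * J = 1 by linarith, mul_one]
      _ ≤ m * J := h3
  have hZcard : Z.card = L := by simp [hZ]
  have hKZ : (K ∪ Z).card ≤ J := by
    have h1 : ((K ∪ Z).card : ℝ) ≤ K.card + Z.card := by exact_mod_cast Finset.card_union_le _ _
    rw [hZcard] at h1
    have : ((K ∪ Z).card : ℝ) ≤ J := by linarith
    exact_mod_cast this
  have hKZX : K ∪ Z ⊆ X := by
    refine Finset.union_subset (Finset.filter_subset _ _) (Finset.product_subset_product_right ?_)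
    simp only [Finset.singleton_subset_iff, Finset.mem_Ico]
    omega
  have hXcard : J ≤ X.card := by
    have : X.card = L * J := by simp [hX]
    rw [this]
    exact Nat.le_mul_of_pos_left _ (by omega)
  obtain ⟨Y, hKY, hYX, hYJ⟩ := Finset.exists_subsuperset_card_eq hKZX hKZ hXcard
  obtain ⟨a, b, hmono, hinj, hY⟩ := exists_enumeration_monotone_fst Y hYJ
  have hmem : ∀ j, (-(g : ℤ) ≤ a j ∧ a j < -g + L) ∧ -(h : ℤ) ≤ b j ∧ b j < -h + J := by
    intro j
    simpa [hX] using hYX ((hY _).2 ⟨j, rfl⟩)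
  obtain ⟨c, hper, hunit⟩ := exists_isUnit_gaborMatrix (L := L) (by omega) (-(g : ℤ)) a b hmono
    (fun j => (hmem j).1.1) (fun j => (hmem j).1.2) (fun l hl1 hl2 => by
      obtain ⟨j, hj⟩ := (hY (l, 0)).1 (hKY (Finset.mem_union_right _ (by simp [hZ, hl1, hl2])))
      exact ⟨j, (congrArg Prod.fst hj).symm⟩)
    -- All frequency indices lie in a window of length `J`, so congruence modulo `J` forces
    -- equality.
    (fun i j hij hd => hinj (Prod.ext hij (by
      have h1 := Int.eq_zero_of_abs_lt_dvd hd (abs_lt.2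
        ⟨by have := hmem i; have := hmem j; omega, by have := hmem i; have := hmem j; omega⟩)
      show b i = b j
      omega)))
  refine ⟨δ, B, J, c, a, b, hδ0, hB0, hJp, hTB, hper, fun p hp => ?_, hunit, hinj⟩
  have hcell : (p.1 - (⌊p.1 / δ⌋ : ℤ) * δ, p.2 - (⌊p.2 / B⌋ : ℤ) * B) ∈ cell δ B :=
    (mem_cell_translate_iff hδ0 hB0 p _ _).2 ⟨rfl, rfl⟩
  have h1 := hfloor hδ0 (hWS p hp).1
  have h2 := hfloor hB0 (hWS p hp).2
  rw [← hg] at h1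
  rw [← hh] at h2
  obtain ⟨j, hj⟩ := (hY (⌊p.1 / δ⌋, ⌊p.2 / B⌋)).1 (hKY (Finset.mem_union_left _
    (Finset.mem_filter.2 ⟨Finset.mem_product.2 ⟨Finset.mem_Ico.2 ⟨by omega, by omega⟩,
      Finset.mem_Ico.2 ⟨by omega, by omega⟩⟩, p, hp, hcell⟩)))
  rw [Prod.mk.injEq] at hj
  rw [hj.1, hj.2] at hcell
  exact Set.mem_iUnion.2 ⟨j, hcell⟩

/-! ### The autocorrelation of the echo. -/

theorem echoKernel_deltaTrain_apply (c : ℤ → ℂ) (T : ℝ) (φ : ℝ → ℂ) (p : ℝ × ℝ) :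
    echoKernel (deltaTrain c T) φ p =
      ∑' k : ℤ, c k * (expi (p.2 * (k * T + p.1)) * φ (k * T + p.1)) := rfl

/-- The autocorrelation of the echo to a delta train in terms of the scattering function. -/
theorem correlation_echo_deltaTrain {Ω : Type*} [MeasurableSpace Ω] {P : Measure Ω}
    {η : SpreadingFunction P} {C : ℝ × ℝ → ℝ} (hη : IsScatteringFunction η C) (c : ℤ → ℂ) {T : ℝ}
    (hT : 0 < T) {φ ψ : ℝ → ℂ} (hφ : IsTestFunction φ) (hψ : IsTestFunction ψ) :
    correlation (echo η (deltaTrain c T) φ) (echo η (deltaTrain c T) ψ) =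
      ∫ p : ℝ × ℝ, conj (echoKernel (deltaTrain c T) φ p) * echoKernel (deltaTrain c T) ψ p
        * (C p : ℂ) := by
  rw [echo, echo, dif_pos (contDiff_echoKernel_deltaTrain c hT hφ),
    dif_pos (contDiff_echoKernel_deltaTrain c hT hψ), hη.wssus]

theorem IsTestFunction.comp_sub_const {φ : ℝ → ℂ} (hφ : IsTestFunction φ) (s : ℝ) :
    IsTestFunction fun t => φ (t - s) :=
  ⟨hφ.1.comp (by fun_prop), hφ.2.comp_homeomorph (Homeomorph.subRight s)⟩

theorem IsTestFunction.exists_bound {E : Type*} [NormedAddCommGroup E] [NormedSpace ℝ E]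
    {φ : E → ℂ} (hφ : IsTestFunction φ) : ∃ K, ∀ x, ‖φ x‖ ≤ K :=
  hφ.1.continuous.bounded_above_of_compact_support hφ.2

theorem eq_zero_of_tsupport_subset {X : Type*} [TopologicalSpace X] {φ : X → ℂ} {U : Set X}
    (h : tsupport φ ⊆ U) {x : X} (hx : x ∉ U) : φ x = 0 :=
  image_eq_zero_of_notMem_tsupport fun hx' => hx (h hx')

/-- At most one of the points `k T + τ` lies in `(0, T)`. -/
theorem lattice_point_unique {T τ : ℝ} (hT : 0 < T) {k l : ℤ} (hk : k * T + τ ∈ Set.Ioo 0 T)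
    (hl : l * T + τ ∈ Set.Ioo 0 T) : k = l := by
  have h1 : ((k - l : ℤ) : ℝ) * T < 1 * T := by push_cast; linarith [hk.2, hl.1]
  have h2 : ((l - k : ℤ) : ℝ) * T < 1 * T := by push_cast; linarith [hk.1, hl.2]
  have h3 : k - l < 1 := by exact_mod_cast lt_of_mul_lt_mul_right h1 hT.le
  have h4 : l - k < 1 := by exact_mod_cast lt_of_mul_lt_mul_right h2 hT.le
  omega

/-- At a given delay only one `k` puts `kT + τ` into `(0, T)`, so the double sum over deltas
collapses to pairs `(k + n, k)`, whose phases cancel up to `e^{-2πiγnT}`. The finite set `s` may be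
any set containing that `k`. -/
theorem conj_echoKernel_mul_echoKernel (c : ℤ → ℂ) {T : ℝ} (hT : 0 < T) {φ ψ : ℝ → ℂ}
    (hφ : tsupport φ ⊆ Set.Ioo 0 T) (hψ : tsupport ψ ⊆ Set.Ioo 0 T) (n : ℤ) (p : ℝ × ℝ)
    (s : Finset ℤ) (hs : ∀ k : ℤ, k * T + p.1 ∈ Set.Ioo 0 T → k ∈ s) :
    conj (echoKernel (deltaTrain c T) (fun t => φ (t - n * T)) p) *
      echoKernel (deltaTrain c T) ψ p =
    ∑ k ∈ s, conj (c (k + n)) * c k * (expi (-(p.2 * (n * T))) *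
      (conj (φ (k * T + p.1)) * ψ (k * T + p.1))) := by
  by_cases h : ∃ k : ℤ, k * T + p.1 ∈ Set.Ioo 0 T
  · obtain ⟨k, hk⟩ := h
    have hne : ∀ {χ : ℝ → ℂ}, tsupport χ ⊆ Set.Ioo 0 T → ∀ l : ℤ, l ≠ k → χ (l * T + p.1) = 0 :=
      fun hχ l hl => eq_zero_of_tsupport_subset hχ fun h => hl (lattice_point_unique hT h hk)
    rw [echoKernel_deltaTrain_apply, echoKernel_deltaTrain_apply, tsum_eq_single (k + n),
      tsum_eq_single k, Finset.sum_eq_single_of_mem k (hs k hk)]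
    · rw [show ((k + n : ℤ) : ℝ) * T + p.1 - n * T = k * T + p.1 by push_cast; ring,
        show p.2 * (((k + n : ℤ) : ℝ) * T + p.1) = p.2 * (k * T + p.1) + p.2 * (n * T) by
          push_cast; ring]
      simp only [map_mul, conj_expi, expi_add]
      have h1 : expi (-(p.2 * (k * T + p.1))) * expi (p.2 * (k * T + p.1)) = 1 := by
        rw [← expi_add, neg_add_cancel, expi_zero]
      linear_combination (conj (c (k + n)) * c k * expi (-(p.2 * (n * T))) *
        conj (φ (k * T + p.1)) * ψ (k * T + p.1)) * h1
    · intro l _ hl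
      rw [hne hψ l hl]; simp
    · intro l hl
      rw [hne hψ l hl]; simp
    · intro l hl
      have : (l : ℝ) * T + p.1 - n * T = ((l - n : ℤ) : ℝ) * T + p.1 := by push_cast; ring
      rw [this, hne hφ (l - n) (by omega)]; simp
  · push Not at h
    have hz : ∀ k : ℤ, ψ (k * T + p.1) = 0 := fun k => eq_zero_of_tsupport_subset hψ (h k)
    rw [echoKernel_deltaTrain_apply c T ψ]
    simp [hz]

theorem integrable_expi_mul {C : ℝ × ℝ → ℝ} (hC : Integrable C) (s : ℝ) :
    Integrable fun p : ℝ × ℝ => expi (-(p.2 * s)) * (C p : ℂ) :=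
  hC.ofReal.bdd_mul (c := 1) (by fun_prop : Continuous _).aestronglyMeasurable
    (Eventually.of_forall fun _ => (norm_expi _).le)

theorem integrable_channelACF {C : ℝ × ℝ → ℝ} (hC : Integrable C) (s : ℝ) :
    Integrable (channelACF C s) :=
  (integrable_expi_mul hC s).integral_prod_left

/-- Only finitely many terms of `echoACF` are nonzero on `(0, T)`. -/
theorem exists_echoACF_range {C : ℝ × ℝ → ℝ} (hC : HasCompactSupport C) {T : ℝ} (hT : 0 < T) :
    ∃ s : Finset ℤ, (∀ p : ℝ × ℝ, C p ≠ 0 → ∀ k : ℤ, k * T + p.1 ∈ Set.Ioo 0 T → k ∈ s) ∧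
      ∀ c n, ∀ t ∈ Set.Ioo 0 T, echoACF c T C n t =
        ∑ k ∈ s, conj (c (k + n)) * c k * channelACF C (n * T) (t - k * T) := by
  obtain ⟨R, hR⟩ := hC.isCompact.isBounded.subset_closedBall 0
  have hz : ∀ p : ℝ × ℝ, C p ≠ 0 → |p.1| ≤ R := fun p hp => by
    have := hR (subset_tsupport C hp)
    simp only [Metric.mem_closedBall, dist_zero_right, Prod.norm_def, Real.norm_eq_abs] at this
    exact (le_max_left _ _).trans this
  obtain ⟨N, hN⟩ := exists_nat_gt ((R + T) / T)
  rw [div_lt_iff₀ hT] at hN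
  have key : ∀ p : ℝ × ℝ, C p ≠ 0 → ∀ k : ℤ, k * T + p.1 ∈ Set.Ioo 0 T →
      k ∈ Finset.Icc (-(N : ℤ)) N := by
    intro p hp k hk
    have h1 := abs_le.1 (hz p hp)
    have h2 : (k : ℝ) * T < N * T := by linarith [hk.2]
    have h3 : ((-N : ℤ) : ℝ) * T < k * T := by push_cast; linarith [hk.1]
    have h4 : k < N := by exact_mod_cast lt_of_mul_lt_mul_right h2 hT.le
    have h5 : -(N : ℤ) < k := by exact_mod_cast lt_of_mul_lt_mul_right h3 hT.le
    exact Finset.mem_Icc.2 ⟨h5.le, h4.le⟩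
  refine ⟨_, key, fun c n t ht => tsum_eq_sum fun k hk => ?_⟩
  have : ∀ γ, C (t - k * T, γ) = 0 := by
    intro γ
    by_contra h
    exact hk (key _ h k (by simpa using ht))
  simp [channelACF, this]

theorem integrableOn_echoACF {C : ℝ × ℝ → ℝ} (hC : Integrable C) (hC' : HasCompactSupport C)
    (c : ℤ → ℂ) {T : ℝ} (hT : 0 < T) (n : ℤ) : IntegrableOn (echoACF c T C n) (Set.Ioo 0 T) := by
  obtain ⟨s, -, hs⟩ := exists_echoACF_range hC' hT
  have h1 : Integrable fun t =>
      ∑ k ∈ s, conj (c (k + n)) * c k * channelACF C (n * T) (t - k * T) :=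
    integrable_finsetSum _ fun k _ => ((integrable_channelACF hC _).comp_sub_right _).const_mul _
  exact h1.integrableOn.congr_fun (fun t ht => (hs c n t ht).symm) measurableSet_Ioo

/-- The echo autocorrelations are given by `echoACF`. -/
theorem isEchoAutocorrelation_echoACF {Ω : Type*} [MeasurableSpace Ω] {P : Measure Ω}
    {η : SpreadingFunction P} {C : ℝ × ℝ → ℝ} (hη : IsScatteringFunction η C) (c : ℤ → ℂ) {T : ℝ}
    (hT : 0 < T) : IsEchoAutocorrelation (echo η (deltaTrain c T)) T (echoACF c T C) := by
  intro n
  refine ⟨integrableOn_echoACF hη.integrable hη.hasCompactSupport c hT n,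
    fun φ ψ hφ hψ hφT hψT => ?_⟩
  rw [correlation_echo_deltaTrain hη c hT (hφ.comp_sub_const _) hψ]
  obtain ⟨s, hs, hacf⟩ := exists_echoACF_range hη.hasCompactSupport hT
  obtain ⟨K, hK⟩ := hφ.exists_bound
  obtain ⟨K', hK'⟩ := hψ.exists_bound
  have hφc := hφ.1.continuous
  have hψc := hψ.1.continuous
  have hK0 : 0 ≤ K := (norm_nonneg _).trans (hK 0)
  have hb : ∀ t, ‖conj (φ t) * ψ t‖ ≤ K * K' := fun t => by
    rw [norm_mul, RCLike.norm_conj]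
    exact mul_le_mul (hK t) (hK' t) (norm_nonneg _) hK0
  set f : ℤ → ℝ × ℝ → ℂ := fun k p => conj (c (k + n)) * c k *
    ((conj (φ (k * T + p.1)) * ψ (k * T + p.1)) * (expi (-(p.2 * (n * T))) * (C p : ℂ))) with hf
  have hfint : ∀ k, Integrable (f k) := fun k =>
    ((integrable_expi_mul hη.integrable _).bdd_mul (c := K * K')
      (by fun_prop : Continuous _).aestronglyMeasurable
      (Eventually.of_forall fun _ => hb _)).const_mul _
  have h1 : ∀ p : ℝ × ℝ, conj (echoKernel (deltaTrain c T) (fun t => φ (t - n * T)) p) *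
      echoKernel (deltaTrain c T) ψ p * (C p : ℂ) = ∑ k ∈ s, f k p := by
    intro p
    by_cases hp : C p = 0
    · simp [hp, hf]
    · rw [conj_echoKernel_mul_echoKernel c hT hφT hψT n p s (hs p hp), Finset.sum_mul]
      refine Finset.sum_congr rfl fun k _ => ?_
      simp only [hf]; ring
  -- Fubini and the substitution `t = kT + τ`; the inner integral over Doppler is the channel
  -- autocorrelation.
  have h2 : ∀ k, ∫ p, f k p = ∫ t, conj (c (k + n)) * c k * ((conj (φ t) * ψ t) *
      channelACF C (n * T) (t - k * T)) := by
    intro k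
    rw [Measure.volume_eq_prod, integral_prod _ (by simpa [Measure.volume_eq_prod] using hfint k)]
    simp only [hf, integral_const_mul]
    rw [← integral_add_left_eq_self (fun t => (conj (φ t) * ψ t) *
      channelACF C (n * T) (t - k * T)) (k * T)]
    simp only [add_sub_cancel_left, channelACF]
  have h3 : ∀ k ∈ s, Integrable fun t => conj (c (k + n)) * c k * ((conj (φ t) * ψ t) *
      channelACF C (n * T) (t - k * T)) := fun k _ =>
    (((integrable_channelACF hη.integrable _).comp_sub_right _).bdd_mul (c := K * K')
      (by fun_prop : Continuous _).aestronglyMeasurable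
      (Eventually.of_forall fun _ => hb _)).const_mul _
  simp only [h1]
  rw [integral_finsetSum _ fun k _ => hfint k]
  simp only [h2]
  rw [← integral_finsetSum _ h3, ← setIntegral_eq_integral_of_forall_compl_eq_zero (s := Set.Ioo 0 T)]
  · refine setIntegral_congr_fun measurableSet_Ioo fun t ht => ?_
    simp only [hacf c n t ht, Finset.sum_mul]
    refine Finset.sum_congr rfl fun k _ => by ring
  · intro t ht
    simp [eq_zero_of_tsupport_subset hψT ht]

/-- A compact subset of `(0, T)` carries a test function that is one on it. -/
theorem exists_testFunction_eq_one {T : ℝ} (hT : 0 < T) {K : Set ℝ} (hK : IsClosed K)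
    (hKT : K ⊆ Set.Ioo 0 T) : ∃ φ : ℝ → ℂ, IsTestFunction φ ∧ tsupport φ ⊆ Set.Ioo 0 T ∧
      ∀ t ∈ K, φ t = 1 := by
  have hball : Set.Ioo 0 T = Metric.ball (T / 2) (T / 2) := by
    rw [Real.ball_eq_Ioo]; congr 1 <;> ring
  rw [hball] at hKT ⊢
  obtain ⟨r, ⟨hr0, hrT⟩, hKr⟩ := exists_pos_lt_subset_ball (by positivity) hK hKT
  let f : ContDiffBump (T / 2) := ⟨r, (r + T / 2) / 2, hr0, by linarith⟩
  refine ⟨fun t => (f t : ℂ), ⟨Complex.ofRealCLM.contDiff.comp f.contDiff,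
    f.hasCompactSupport.comp_left Complex.ofReal_zero⟩, ?_, fun t ht => ?_⟩
  · refine (tsupport_comp_subset Complex.ofReal_zero _).trans ?_
    rw [f.tsupport_eq]
    exact Metric.closedBall_subset_ball (by show (r + T / 2) / 2 < T / 2; linarith)
  · have := f.one_of_mem_closedBall (Metric.ball_subset_closedBall (hKr ht))
    simp [this]

/-- The echo autocorrelations determine the functions `Π n` almost everywhere. -/
theorem IsEchoAutocorrelation.ae_eq {Ω : Type*} [MeasurableSpace Ω] {P : Measure Ω}
    {y : (ℝ → ℂ) → Lp ℂ 2 P} {T : ℝ} (hT : 0 < T) {Pi Pi' : ℤ → ℝ → ℂ}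
    (h : IsEchoAutocorrelation y T Pi) (h' : IsEchoAutocorrelation y T Pi') (n : ℤ) :
    Pi n =ᵐ[volume.restrict (Set.Ioo 0 T)] Pi' n := by
  have hint : IntegrableOn (fun t => Pi n t - Pi' n t) (Set.Ioo 0 T) := (h n).1.sub (h' n).1
  have := isOpen_Ioo.ae_eq_zero_of_integral_contDiff_smul_eq_zero (μ := volume)
    hint.locallyIntegrableOn ?_
  · rw [EventuallyEq, ae_restrict_iff' measurableSet_Ioo]
    filter_upwards [this] with t ht hmem
    exact sub_eq_zero.1 (ht hmem)
  intro g hg hgc hgs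
  -- With `φ = 1` on the support of `g`, the product `conj φ * g` is `g`, so the bilinear pairing
  -- tests `Π_n` against an arbitrary `g`.
  obtain ⟨φ, hφ, hφT, hφ1⟩ := exists_testFunction_eq_one hT (isClosed_tsupport g) hgs
  have hψ : IsTestFunction fun t => (g t : ℂ) :=
    ⟨Complex.ofRealCLM.contDiff.comp hg, hgc.comp_left Complex.ofReal_zero⟩
  have hψT : tsupport (fun t => (g t : ℂ)) ⊆ Set.Ioo 0 T :=
    (tsupport_comp_subset Complex.ofReal_zero _).trans hgs
  have e1 := (h n).2 φ _ hφ hψ hφT hψT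
  rw [(h' n).2 φ _ hφ hψ hφT hψT] at e1
  have hmul : ∀ t, conj (φ t) * (g t : ℂ) = g t := by
    intro t
    by_cases ht : t ∈ tsupport g
    · simp [hφ1 t ht]
    · simp [image_eq_zero_of_notMem_tsupport ht]
  simp only [mul_assoc, hmul] at e1
  have hgi : ∀ {q : ℝ → ℂ}, IntegrableOn q (Set.Ioo 0 T) →
      Integrable (fun t => q t * (g t : ℂ)) (volume.restrict (Set.Ioo 0 T)) := by
    intro q hq
    obtain ⟨K, hK⟩ := hψ.exists_bound
    exact hq.mul_bdd (c := K) hψ.1.continuous.aestronglyMeasurable (Eventually.of_forall hK)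
  rw [← setIntegral_eq_integral_of_forall_compl_eq_zero (s := Set.Ioo 0 T)]
  · have h2 : ∀ t, g t • (Pi n t - Pi' n t) = Pi n t * (g t : ℂ) - Pi' n t * (g t : ℂ) :=
      fun t => by rw [Complex.real_smul]; ring
    simp only [h2]
    rw [integral_sub (hgi (h n).1) (hgi (h' n).1), e1, sub_self]
  · intro t ht
    rw [image_eq_zero_of_notMem_tsupport fun h => ht (hgs h), zero_smul]

/-! ### Patches and their Fourier coefficients. -/

theorem measurableSet_cell (T B : ℝ) : MeasurableSet (cell T B) :=
  measurableSet_Ico.prod measurableSet_Ico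

/-- The patches reassemble the function. -/
theorem eq_sum_patch {T B : ℝ} (hT : 0 < T) (hB : 0 < B) {J : ℕ} {a b : Fin J → ℤ}
    (hab : Function.Injective fun j => (a j, b j)) {C : ℝ × ℝ → ℝ}
    (hC : Function.support C ⊆ cellUnion T B a b) (p : ℝ × ℝ) :
    (C p : ℂ) = ∑ j : Fin J, patch T B a b C j (p.1 - a j * T, p.2 - b j * B) := by
  by_cases hp : p ∈ cellUnion T B a b
  · obtain ⟨j, hj⟩ := Set.mem_iUnion.1 hp
    rw [Set.mem_ofPred_eq] at hj
    rw [Finset.sum_eq_single j, patch, Set.indicator_of_mem hj]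
    · simp
    · intro i _ hij
      refine Set.indicator_of_notMem (fun hi => hij ?_) _
      rw [mem_cell_translate_iff hT hB] at hi hj
      exact hab (Prod.ext (hi.1.trans hj.1.symm) (hi.2.trans hj.2.symm))
    · simp
  · rw [Finset.sum_eq_zero]
    · have h0 : C p = 0 := by
        by_contra h
        exact hp (hC h)
      rw [h0, Complex.ofReal_zero]
    · intro j _
      rw [patch, Set.indicator_of_notMem]
      exact fun hj => hp (Set.mem_iUnion.2 ⟨j, hj⟩)

theorem integrable_patch {T B : ℝ} {J : ℕ} (a b : Fin J → ℤ) {C : ℝ × ℝ → ℝ} (hC : Integrable C)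
    (j : Fin J) : Integrable (patch T B a b C j) :=
  Integrable.indicator (hC.comp_add_right (a j * T, b j * B)).ofReal (measurableSet_cell T B)

theorem memLp_patch {T B : ℝ} {J : ℕ} (a b : Fin J → ℤ) {C : ℝ × ℝ → ℝ} (hC : MemLp C 2)
    (j : Fin J) : MemLp (patch T B a b C j) 2 :=
  MemLp.indicator (measurableSet_cell T B) (hC.comp_measurePreserving
    (measurePreserving_add_right volume ((a j * T, b j * B) : ℝ × ℝ))).ofReal

/-- The periodized combination `∑ j, A_{rj} C_j` of the patches. -/
noncomputable def patchMix (c : ℤ → ℂ) (T B : ℝ) {J : ℕ} (a b : Fin J → ℤ) (C : ℝ × ℝ → ℝ)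
    (r : Fin J) (p : ℝ × ℝ) : ℂ :=
  ∑ j, gaborMatrix c a b r j * patch T B a b C j p

theorem patchMix_eq_zero (c : ℤ → ℂ) {T B : ℝ} {J : ℕ} (a b : Fin J → ℤ) (C : ℝ × ℝ → ℝ)
    (r : Fin J) {p : ℝ × ℝ} (hp : p ∉ cell T B) : patchMix c T B a b C r p = 0 := by
  simp [patchMix, patch, hp]

theorem integrable_patchMix (c : ℤ → ℂ) {T B : ℝ} {J : ℕ} (a b : Fin J → ℤ) {C : ℝ × ℝ → ℝ}
    (hC : Integrable C) (r : Fin J) : Integrable (patchMix c T B a b C r) :=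
  integrable_finsetSum _ fun j _ => (integrable_patch a b hC j).const_mul _

theorem memLp_patchMix (c : ℤ → ℂ) {T B : ℝ} {J : ℕ} (a b : Fin J → ℤ) {C : ℝ × ℝ → ℝ}
    (hC : MemLp C 2) (r : Fin J) : MemLp (patchMix c T B a b C r) 2 :=
  memLp_finsetSum _ fun j _ => (memLp_patch a b hC j).const_mul _

theorem patch_eq_sum_patchMix {c : ℤ → ℂ} {T B : ℝ} {J : ℕ} {a b : Fin J → ℤ}
    (hA : IsUnit (gaborMatrix c a b)) (C : ℝ × ℝ → ℝ) (j : Fin J) (p : ℝ × ℝ) :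
    patch T B a b C j p = ∑ r, (gaborMatrix c a b)⁻¹ j r * patchMix c T B a b C r p := by
  have h1 : (gaborMatrix c a b)⁻¹.mulVec ((gaborMatrix c a b).mulVec
      fun j => patch T B a b C j p) = fun j => patch T B a b C j p := by
    rw [Matrix.mulVec_mulVec, Matrix.nonsing_inv_mul _ ((Matrix.isUnit_iff_isUnit_det _).1 hA),
      Matrix.one_mulVec]
  exact (congrFun h1 j).symm

/-- On `(0, T)` the echo autocorrelations are Fourier integrals of the patches. -/
theorem echoACF_eq_sum_patch (c : ℤ → ℂ) {T B : ℝ} (hT : 0 < T) (hB : 0 < B) {J : ℕ}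
    {a b : Fin J → ℤ} (hab : Function.Injective fun j => (a j, b j)) {C : ℝ × ℝ → ℝ}
    (hC : Function.support C ⊆ cellUnion T B a b) {t : ℝ} (ht : t ∈ Set.Ioo 0 T)
    (hint : ∀ j, Integrable fun γ => patch T B a b C j (t, γ)) (n : ℤ) :
    echoACF c T C n t = ∑ j, conj (c (n - a j)) * c (-a j) *
      ∫ γ, expi (-((γ + b j * B) * (n * T))) * patch T B a b C j (t, γ) := by
  -- For `0 < t < T` the point `t - kT` lies in time column `-k`, so only the patches with `a j =
  -- -k` contribute.
  have hslice : ∀ (k : ℤ) (γ : ℝ), (C (t - k * T, γ) : ℂ) =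
      ∑ j, if k = -a j then patch T B a b C j (t, γ - b j * B) else 0 := by
    intro k γ
    rw [eq_sum_patch hT hB hab hC]
    refine Finset.sum_congr rfl fun j _ => ?_
    split_ifs with h
    · subst h
      congr 2
      push_cast; ring
    · refine Set.indicator_of_notMem (fun hmem => h ?_) _
      have h1 : t / T ∈ Set.Ioo 0 1 := ⟨div_pos ht.1 hT, (div_lt_one hT).2 ht.2⟩
      have h2 := ((mem_cell_translate_iff hT hB (t - k * T, γ) _ _).1 hmem).1
      have h3 : (t - k * T) / T = t / T - (k : ℤ) := by field_simp
      rw [h3, Int.floor_sub_intCast, Int.floor_eq_zero_iff.2 ⟨h1.1.le, h1.2⟩] at h2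
      omega
  have hint' : ∀ j, Integrable fun γ => expi (-(γ * (n * T))) *
      patch T B a b C j (t, γ - b j * B) := fun j =>
    ((hint j).comp_sub_right (b j * B)).bdd_mul (c := 1)
      (by fun_prop : Continuous _).aestronglyMeasurable
      (Eventually.of_forall fun _ => (norm_expi _).le)
  have hshift : ∀ j, ∫ γ, expi (-(γ * (n * T))) * patch T B a b C j (t, γ - b j * B) =
      ∫ γ, expi (-((γ + b j * B) * (n * T))) * patch T B a b C j (t, γ) := fun j => by
    rw [← integral_add_right_eq_self _ (b j * B)]
    simp only [add_sub_cancel_right]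
  have hacf : ∀ k : ℤ, channelACF C (n * T) (t - k * T) = ∑ j, if k = -a j then
      ∫ γ, expi (-((γ + b j * B) * (n * T))) * patch T B a b C j (t, γ) else 0 := by
    intro k
    simp only [channelACF, hslice, Finset.mul_sum]
    rw [integral_finsetSum]
    · refine Finset.sum_congr rfl fun j _ => ?_
      split_ifs with h
      · exact hshift j
      · simp
    · intro j _
      split_ifs with h
      · exact hint' j
      · simp
  simp only [echoACF, hacf, Finset.mul_sum]
  rw [Summable.tsum_finsetSum]
  · refine Finset.sum_congr rfl fun j _ => ?_
    rw [tsum_eq_single (-a j)]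
    · rw [if_pos rfl, neg_add_eq_sub]
    · intro k hk
      rw [if_neg hk, mul_zero]
  · intro j _
    refine summable_of_ne_finset_zero (s := {-a j}) fun k hk => ?_
    rw [if_neg (by simpa using hk), mul_zero]

/-- Sorted by residues modulo `J`, the echo autocorrelations are Fourier coefficients. -/
theorem echoACF_eq_integral_patchMix {c : ℤ → ℂ} {T B : ℝ} (hT : 0 < T) (hB : 0 < B) {J : ℕ}
    (hJ : J * T * B = 1) (hc : Function.Periodic c (J : ℤ))
    {a b : Fin J → ℤ} (hab : Function.Injective fun j => (a j, b j)) {C : ℝ × ℝ → ℝ}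
    (hC : Function.support C ⊆ cellUnion T B a b) {t : ℝ} (ht : t ∈ Set.Ioo 0 T)
    (hint : ∀ j, Integrable fun γ => patch T B a b C j (t, γ)) (m : ℤ) (r : Fin J) :
    echoACF c T C (m * J + (r : ℕ)) t =
      ∫ γ, expi (-(γ * T * (m * J + (r : ℕ)))) * patchMix c T B a b C r (t, γ) := by
  rw [echoACF_eq_sum_patch c hT hB hab hC ht hint]
  have hint' : ∀ j, Integrable fun γ => expi (-(γ * T * (m * J + (r : ℕ)))) *
      (gaborMatrix c a b r j * patch T B a b C j (t, γ)) := fun j =>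
    ((hint j).const_mul _).bdd_mul (c := 1) (by fun_prop : Continuous _).aestronglyMeasurable
      (Eventually.of_forall fun _ => (norm_expi _).le)
  simp only [patchMix, Finset.mul_sum]
  rw [integral_finsetSum _ fun j _ => hint' j]
  refine Finset.sum_congr rfl fun j _ => ?_
  rw [← integral_const_mul]
  congr 1
  ext γ
  have hJ0 : (J : ℝ) ≠ 0 := by rintro h; simp [h] at hJ
  -- As `BT = 1 / J`, the shift by `b_j B` contributes the matrix phase `e^{-2πi r b_j/J}` and a
  -- factor `e^{-2πi b_j m} = 1`.
  have h1 : -((γ + b j * B) * (((m * J + (r : ℕ) : ℤ) : ℝ) * T)) =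
      -(γ * T * (m * J + (r : ℕ))) + -((r : ℕ) * b j / J) + ((-(b j * m) : ℤ) : ℝ) := by
    have h2 : B * T = 1 / J := by field_simp; linarith
    push_cast
    linear_combination (-(b j : ℝ) * (m * J + (r : ℕ))) * h2 - b j * m * mul_one_div_cancel hJ0
  have h3 : c (m * J + (r : ℕ) - a j) = c ((r : ℕ) - a j) := by
    have := hc.int_mul m ((r : ℕ) - a j : ℤ)
    rw [← this]
    congr 1
    simp; ring
  rw [h1, expi_add, expi_add, expi_int, h3, gaborMatrix, Matrix.of_apply]
  ring

/-! ### Weak convergence of Fourier series in Doppler. -/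

theorem fourier_coe_eq_expi {B : ℝ} (m : ℤ) (x : ℝ) :
    fourier m (x : AddCircle B) = expi (x * m / B) := by
  rw [fourier_coe_apply, expi]
  congr 1
  push_cast
  ring

theorem fourierCoeff_eq_integral_expi {B : ℝ} [hB : Fact (0 < B)] {G : AddCircle B → ℂ} {f : ℝ → ℂ}
    (hG : ∀ x ∈ Set.Ioo 0 B, G x = f x) (hf : ∀ x ∉ Set.Ico 0 B, f x = 0) (m : ℤ) :
    fourierCoeff G m = (B : ℂ)⁻¹ * ∫ x, expi (-(x * m / B)) * f x := by
  rw [fourierCoeff_eq_intervalIntegral _ _ 0, zero_add, intervalIntegral.integral_of_le hB.out.le,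
    integral_Ioc_eq_integral_Ioo, setIntegral_congr_fun (g := fun x => expi (-(x * m / B)) * f x)
    measurableSet_Ioo, ← integral_Ico_eq_integral_Ioo,
    setIntegral_eq_integral_of_forall_compl_eq_zero]
  · rw [Complex.real_smul]
    push_cast
    rw [one_div]
  · intro x hx
    rw [hf x hx, mul_zero]
  · intro x hx
    simp only [hG x hx, fourier_coe_eq_expi, smul_eq_mul]
    congr 2
    push_cast
    ring

/-- Pointwise Fourier inversion on `[0, B)`. -/
theorem hasSum_fourier_of_summable {B : ℝ} (hB : 0 < B) {f : ℝ → ℂ} (hf : Continuous f)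
    (hf0 : ∀ x ∉ Set.Ioo 0 B, f x = 0) (hs : Summable fun m : ℤ => ∫ y, f y * expi (y * m / B))
    {x : ℝ} (hx : x ∈ Set.Ico 0 B) :
    HasSum (fun m : ℤ => (B : ℂ)⁻¹ * (∫ y, f y * expi (y * m / B)) * expi (-(x * m / B))) (f x) := by
  have : Fact (0 < B) := ⟨hB⟩
  have hf00 : f 0 = f B := by rw [hf0 0 (by simp), hf0 B (by simp)]
  let F : C(AddCircle B, ℂ) := ⟨AddCircle.liftIco B 0 f,
    AddCircle.liftIco_zero_continuous hf00 hf.continuousOn⟩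
  have hF : ∀ y ∈ Set.Ico 0 B, F y = f y := fun y hy => AddCircle.liftIco_zero_coe_apply hy
  -- The integrals against `expi (y * m / B)` carry the opposite sign from Fourier coefficients,
  -- hence the reflection of `ℤ`.
  have hcoef : ∀ m : ℤ, fourierCoeff F (-m) = (B : ℂ)⁻¹ * ∫ y, f y * expi (y * m / B) := by
    intro m
    rw [fourierCoeff_eq_integral_expi (fun y hy => hF y (Set.Ioo_subset_Ico_self hy))
      (fun y hy => hf0 y fun h => hy (Set.Ioo_subset_Ico_self h))]
    congr 2
    ext y
    rw [mul_comm]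
    congr 2
    push_cast
    ring
  have hsum : Summable (fourierCoeff F) := by
    rw [← (Equiv.neg ℤ).summable_iff]
    exact (hs.mul_left (B : ℂ)⁻¹).congr fun m => (hcoef m).symm
  have h1 := has_pointwise_sum_fourier_series_of_summable hsum (x : AddCircle B)
  rw [← (Equiv.neg ℤ).hasSum_iff, hF x hx] at h1
  refine h1.congr_fun fun m => ?_
  simp only [Function.comp_apply, Equiv.neg_apply, hcoef, fourier_coe_eq_expi, smul_eq_mul]
  congr 2
  push_cast
  ring

theorem IsTestFunction.integrable {φ : ℝ × ℝ → ℂ} (hφ : IsTestFunction φ) : Integrable φ :=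
  hφ.1.continuous.integrable_of_hasCompactSupport hφ.2

/-- The partial derivative in the second variable of a test function. -/
theorem IsTestFunction.fderiv_snd {φ : ℝ × ℝ → ℂ} (hφ : IsTestFunction φ) :
    IsTestFunction fun p => fderiv ℝ φ p (0, 1) :=
  ⟨(hφ.1.fderiv_right (m := ∞) (by simp)).clm_apply contDiff_const,
    (hφ.2.fderiv ℝ).comp_left (g := fun L : ℝ × ℝ →L[ℝ] ℂ => L (0, 1)) rfl⟩

theorem IsTestFunction.exists_slice_radius {φ : ℝ × ℝ → ℂ} (hφ : IsTestFunction φ) :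
    ∃ R, ∀ t γ, γ ∉ Set.Icc (-R) R → φ (t, γ) = 0 := by
  obtain ⟨R, hR⟩ := hφ.2.isCompact.isBounded.subset_closedBall 0
  refine ⟨R, fun t γ hγ => ?_⟩
  by_contra h
  have := hR (subset_tsupport φ h)
  simp only [Metric.mem_closedBall, dist_zero_right, Prod.norm_def, Real.norm_eq_abs] at this
  exact hγ (abs_le.1 ((le_max_right _ _).trans this))

theorem IsTestFunction.slice {φ : ℝ × ℝ → ℂ} (hφ : IsTestFunction φ) (t : ℝ) :
    IsTestFunction fun γ => φ (t, γ) :=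
  ⟨hφ.1.comp (by fun_prop), by
    obtain ⟨R, hR⟩ := hφ.exists_slice_radius
    exact HasCompactSupport.intro isCompact_Icc fun γ hγ => hR t γ hγ⟩

theorem IsTestFunction.integrable_slice {φ : ℝ × ℝ → ℂ} (hφ : IsTestFunction φ) (t : ℝ) :
    Integrable fun γ => φ (t, γ) :=
  (hφ.slice t).1.continuous.integrable_of_hasCompactSupport (hφ.slice t).2

theorem integrable_mul_expi {f : ℝ → ℂ} (hf : Integrable f) (s : ℝ) :
    Integrable fun γ => f γ * expi (γ * s) :=
  hf.mul_bdd (c := 1) (by fun_prop : Continuous _).aestronglyMeasurable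
    (Eventually.of_forall fun _ => (norm_expi _).le)

theorem hasDerivAt_expi_mul (s x : ℝ) :
    HasDerivAt (fun γ : ℝ => expi (γ * s)) (2 * Real.pi * Complex.I * s * expi (x * s)) x := by
  have h1 : HasDerivAt (fun z : ℂ => Complex.exp (2 * Real.pi * Complex.I * s * z))
      (Complex.exp (2 * Real.pi * Complex.I * s * x) * (2 * Real.pi * Complex.I * s * 1)) (x : ℂ) :=
    ((hasDerivAt_id (x : ℂ)).const_mul _).cexp
  have h2 := h1.comp_ofReal
  have h3 : ∀ y : ℝ, expi (y * s) = Complex.exp (2 * Real.pi * Complex.I * s * y) := fun y => by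
    rw [expi]; congr 1; push_cast; ring
  simp only [h3]
  convert h2 using 1
  ring

/-- Integration by parts in the Doppler variable. -/
theorem IsTestFunction.integral_fderiv_snd_mul_expi {φ : ℝ × ℝ → ℂ} (hφ : IsTestFunction φ)
    (t s : ℝ) : ∫ γ, fderiv ℝ φ (t, γ) (0, 1) * expi (γ * s) =
      -(2 * Real.pi * Complex.I * s) * ∫ γ, φ (t, γ) * expi (γ * s) := by
  have hd : ∀ γ, HasDerivAt (fun γ => φ (t, γ)) (fderiv ℝ φ (t, γ) (0, 1)) γ := fun γ =>
    ((hφ.1.differentiable (by simp)).differentiableAt.hasFDerivAt (x := (t, γ))).comp_hasDerivAt γ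
      ((hasDerivAt_const γ t).prodMk (hasDerivAt_id γ))
  have h := integral_mul_deriv_eq_deriv_mul_of_integrable (fun x _ => hd x)
    (fun x _ => hasDerivAt_expi_mul s x)
    ?_ (integrable_mul_expi (hφ.fderiv_snd.integrable_slice t) s)
    (integrable_mul_expi (hφ.integrable_slice t) s)
  · have h' : ∀ γ, φ (t, γ) * (2 * Real.pi * Complex.I * s * expi (γ * s)) =
        (2 * Real.pi * Complex.I * s) * (φ (t, γ) * expi (γ * s)) := fun γ => by ring
    simp only [h', integral_const_mul] at h
    rw [neg_mul, h, neg_neg]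
  · refine ((integrable_mul_expi (hφ.integrable_slice t) s).const_mul
      (2 * Real.pi * Complex.I * s)).congr (Eventually.of_forall fun γ => ?_)
    simp only [Pi.mul_apply]
    ring

theorem IsTestFunction.exists_integral_slice_bound {φ : ℝ × ℝ → ℂ} (hφ : IsTestFunction φ) :
    ∃ K, ∀ t s : ℝ, ‖∫ γ, φ (t, γ) * expi (γ * s)‖ ≤ K := by
  obtain ⟨K, hK⟩ := hφ.exists_bound
  obtain ⟨R, hz⟩ := hφ.exists_slice_radius
  refine ⟨K * volume.real (Set.Icc (-R) R), fun t s => ?_⟩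
  rw [← setIntegral_eq_integral_of_forall_compl_eq_zero (s := Set.Icc (-R) R)]
  · refine norm_setIntegral_le_of_norm_le_const measure_Icc_lt_top fun γ _ => ?_
    rw [norm_mul, norm_expi, mul_one]
    exact hK _
  · intro γ hγ
    rw [hz t γ hγ, zero_mul]

/-- The Fourier coefficients in the second variable of a test function are summable, uniformly. -/
theorem IsTestFunction.exists_summable_coeff_bound {φ : ℝ × ℝ → ℂ} (hφ : IsTestFunction φ) {B : ℝ}
    (hB : 0 < B) : ∃ K : ℤ → ℝ, Summable K ∧
      ∀ (m : ℤ) (t : ℝ), ‖∫ γ, φ (t, γ) * expi (γ * m / B)‖ ≤ K m := by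
  obtain ⟨K₀, hK₀⟩ := hφ.exists_integral_slice_bound
  obtain ⟨K₂, hK₂⟩ := hφ.fderiv_snd.fderiv_snd.exists_integral_slice_bound
  -- Two integrations by parts give decay `m⁻²`, uniformly in `t`. At `m = 0` that expression is `0`
  -- in Lean, so the trivial bound replaces it.
  refine ⟨fun m => if m = 0 then K₀ else K₂ * (B / (2 * Real.pi)) ^ 2 * (1 / (m : ℝ) ^ 2),
    ?_, fun m t => ?_⟩
  · refine (((Real.summable_one_div_int_pow (p := 2)).2 (by norm_num)).mul_left
      (K₂ * (B / (2 * Real.pi)) ^ 2)).congr_cofinite ?_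
    filter_upwards [(Set.finite_singleton (0 : ℤ)).compl_mem_cofinite] with m hm
    rw [if_neg (by simpa using hm)]
  · have e : ∀ γ : ℝ, γ * m / B = γ * (m / B) := fun γ => mul_div_assoc _ _ _
    simp only [e]
    split_ifs with hm
    · exact hK₀ _ _
    · have h := hK₂ t (m / B)
      rw [hφ.fderiv_snd.integral_fderiv_snd_mul_expi, hφ.integral_fderiv_snd_mul_expi] at h
      simp only [norm_mul, norm_neg, Complex.norm_I, Complex.norm_real, Complex.norm_ofNat,
        mul_one, Real.norm_eq_abs, abs_of_pos Real.pi_pos] at h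
      have hm' : (0 : ℝ) < (m : ℝ) ^ 2 := by positivity
      have h2 : (2 * Real.pi * |(m : ℝ) / B|) * (2 * Real.pi * |(m : ℝ) / B|) =
          (2 * Real.pi / B) ^ 2 * (m : ℝ) ^ 2 := by
        rw [← sq, mul_pow, sq_abs]; ring
      rw [← mul_assoc, h2] at h
      have h3 : 0 < (2 * Real.pi / B) ^ 2 * (m : ℝ) ^ 2 := by positivity
      rw [← le_div_iff₀' h3] at h
      refine h.trans (le_of_eq ?_)
      field_simp

theorem integrable_testFunction_mul_fst {T B : ℝ} {φ : ℝ × ℝ → ℂ} (hφ : IsTestFunction φ)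
    (hφs : tsupport φ ⊆ Set.Ioo 0 T ×ˢ Set.Ioo 0 B) {q : ℝ → ℂ} (hq : IntegrableOn q (Set.Ioo 0 T))
    (b : ℂ) (s : ℝ) : Integrable fun p : ℝ × ℝ => φ p * (b * expi (p.2 * s) * q p.1) := by
  obtain ⟨K, hK⟩ := hφ.exists_bound
  have hφc := hφ.1.continuous
  have h1 : Integrable fun p : ℝ × ℝ => (Set.Ioo 0 T).indicator q p.1 *
      (Set.Ioo 0 B).indicator (fun _ => (1 : ℂ)) p.2 :=
    Integrable.mul_prod ((integrable_indicator_iff measurableSet_Ioo).2 hq)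
      ((integrable_indicator_iff measurableSet_Ioo).2 (integrableOn_const (by simp)))
  refine (h1.bdd_mul (f := fun p : ℝ × ℝ => φ p * (b * expi (p.2 * s))) (c := K * ‖b‖)
    (by fun_prop : Continuous _).aestronglyMeasurable
    (Eventually.of_forall fun p => ?_)).congr (Eventually.of_forall fun p => ?_)
  · rw [norm_mul, norm_mul, norm_expi, mul_one]
    exact mul_le_mul_of_nonneg_right (hK p) (norm_nonneg _)
  · by_cases hp : p ∈ Set.Ioo 0 T ×ˢ Set.Ioo 0 B
    · simp only [Set.indicator_of_mem hp.1, Set.indicator_of_mem hp.2]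
      ring
    · simp [eq_zero_of_tsupport_subset hφs hp]

/-- The Fourier series in the second variable converges weakly for an integrable function. -/
theorem hasSum_integral_fourier_snd {T B : ℝ} (hB : 0 < B) {h : ℝ × ℝ → ℂ} (hh : Integrable h)
    (hh0 : ∀ p ∉ cell T B, h p = 0) {φ : ℝ × ℝ → ℂ} (hφ : IsTestFunction φ)
    (hφs : tsupport φ ⊆ Set.Ioo 0 T ×ˢ Set.Ioo 0 B) :
    HasSum (fun m : ℤ => ∫ p : ℝ × ℝ, φ p * ((B : ℂ)⁻¹ * expi (p.2 * m / B) *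
      ∫ γ, expi (-(γ * m / B)) * h (p.1, γ))) (∫ p, φ p * h p) := by
  obtain ⟨K, hKs, hK⟩ := hφ.exists_summable_coeff_bound hB
  have hφc := hφ.1.continuous
  set u : ℤ → ℝ × ℝ → ℂ := fun m p =>
    (B : ℂ)⁻¹ * (∫ y, φ (p.1, y) * expi (y * m / B)) * expi (-(p.2 * m / B)) with hu
  have hcont : ∀ m, AEStronglyMeasurable (u m) := by
    intro m
    have h1 : StronglyMeasurable fun t => ∫ y, φ (t, y) * expi (y * m / B) :=
      (by fun_prop : Continuous fun q : ℝ × ℝ => φ (q.1, q.2) * expi (q.2 * m / B)).stronglyMeasurable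
        |>.integral_prod_right
    exact (((h1.comp_measurable measurable_fst).const_mul _).mul
      (by fun_prop : Continuous fun p : ℝ × ℝ => expi (-(p.2 * m / B))).stronglyMeasurable)
        |>.aestronglyMeasurable
  have hub : ∀ m p, ‖u m p‖ ≤ B⁻¹ * K m := by
    intro m p
    simp only [hu, norm_mul, norm_expi, mul_one, norm_inv, Complex.norm_real, Real.norm_eq_abs,
      abs_of_pos hB]
    exact mul_le_mul_of_nonneg_left (hK m p.1) (by positivity)
  have hui : ∀ m, Integrable fun p => u m p * h p := fun m =>
    hh.bdd_mul (c := B⁻¹ * K m) (hcont m) (Eventually.of_forall (hub m))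
  -- Duality: for fixed `t` both sides are the same product of two Doppler integrals, so the series
  -- is moved from the merely integrable `h` to the smooth `φ`, whose series converges absolutely.
  have hterm : ∀ m : ℤ, ∫ p : ℝ × ℝ, φ p * ((B : ℂ)⁻¹ * expi (p.2 * m / B) *
      ∫ γ, expi (-(γ * m / B)) * h (p.1, γ)) = ∫ p, u m p * h p := by
    intro m
    have hint : Integrable (fun p : ℝ × ℝ => expi (-(p.2 * m / B)) * h p) :=
      hh.bdd_mul (c := 1) (by fun_prop : Continuous _).aestronglyMeasurable
        (Eventually.of_forall fun _ => (norm_expi _).le)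
    have hint2 : Integrable (fun t : ℝ => ∫ γ, expi (-(γ * m / B)) * h (t, γ)) :=
      hint.integral_prod_left
    have hL := integrable_testFunction_mul_fst hφ hφs hint2.integrableOn (B : ℂ)⁻¹ (m / B)
    have hR := hui m
    simp only [← mul_div_assoc] at hL
    rw [Measure.volume_eq_prod] at hL hR ⊢
    rw [integral_prod _ hL, integral_prod _ hR]
    congr 1
    ext t
    have e1 : ∀ γ, φ (t, γ) * ((B : ℂ)⁻¹ * expi (γ * m / B) *
        ∫ y, expi (-(y * m / B)) * h (t, y)) = ((B : ℂ)⁻¹ * ∫ y, expi (-(y * m / B)) * h (t, y)) *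
        (φ (t, γ) * expi (γ * m / B)) := fun γ => by ring
    have e2 : ∀ γ, u m (t, γ) * h (t, γ) = ((B : ℂ)⁻¹ * ∫ y, φ (t, y) * expi (y * m / B)) *
        (expi (-(γ * m / B)) * h (t, γ)) := fun γ => by simp only [hu]; ring
    simp only [e1, e2, integral_const_mul]
    ring
  simp only [hterm]
  have hv : ∫ p, φ p * h p = ∫ p, ∑' m, u m p * h p := by
    congr 1
    ext p
    by_cases hp : p ∈ cell T B
    · rw [tsum_mul_right]
      congr 1
      refine (HasSum.tsum_eq ?_).symm
      refine hasSum_fourier_of_summable hB (hφ.slice p.1).1.continuous (fun y hy => ?_)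
        (Summable.of_norm_bounded hKs fun m => hK m p.1) hp.2
      exact eq_zero_of_tsupport_subset hφs fun h => hy h.2
    · simp [hh0 p hp]
  rw [hv]
  refine hasSum_integral_of_summable_integral_norm hui ?_
  refine Summable.of_nonneg_of_le (fun m => integral_nonneg fun _ => norm_nonneg _) (fun m => ?_)
    ((hKs.mul_left B⁻¹).mul_right (∫ p, ‖h p‖))
  rw [← integral_const_mul]
  refine integral_mono (hui m).norm (hh.norm.const_mul _) fun p => ?_
  simp only [norm_mul]
  exact mul_le_mul_of_nonneg_right (hub m p) (norm_nonneg _)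

/-- Subtracting a partial orthonormal expansion does not increase the norm. -/
theorem Orthonormal.norm_sub_sum_inner_smul_le {E ι : Type*} [NormedAddCommGroup E]
    [InnerProductSpace ℂ E] {e : ι → E} (he : Orthonormal ℂ e) (x : E) (s : Finset ι) :
    ‖x - ∑ i ∈ s, inner ℂ (e i) x • e i‖ ≤ ‖x‖ := by
  set y := ∑ i ∈ s, inner ℂ (e i) x • e i with hy
  have h1 : inner ℂ y (x - y) = 0 := by
    nth_rewrite 1 [hy]
    rw [sum_inner]
    refine Finset.sum_eq_zero fun i hi => ?_
    rw [inner_smul_left, inner_sub_right, hy, he.inner_right_sum _ hi, sub_self, mul_zero]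
  have h2 := norm_add_sq_eq_norm_sq_add_norm_sq_of_inner_eq_zero y (x - y) h1
  rw [add_sub_cancel] at h2
  nlinarith [norm_nonneg x, norm_nonneg (x - y), mul_self_nonneg ‖y‖]

/-- The remainder of the Fourier series of `f` on `[0, B)`. -/
noncomputable def fourierRemainder (B : ℝ) (f : ℝ → ℂ) (s : Finset ℤ) (x : ℝ) : ℂ :=
  f x - ∑ m ∈ s, (B : ℂ)⁻¹ * expi (x * m / B) * ∫ γ, expi (-(γ * m / B)) * f γ

/-- Completeness of the Fourier basis gives the limit. The bound uniform in `s` serves as the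
dominating function when slices are integrated over `t`. -/
theorem eLpNorm_fourierRemainder {B : ℝ} (hB : 0 < B) {f : ℝ → ℂ} (hf : MemLp f 2)
    (hf0 : ∀ x ∉ Set.Ico 0 B, f x = 0) :
    (∀ s, eLpNorm (fourierRemainder B f s) 2 (volume.restrict (Set.Ico 0 B)) ≤
      eLpNorm f 2 (volume.restrict (Set.Ico 0 B))) ∧
    Tendsto (fun s => eLpNorm (fourierRemainder B f s) 2 (volume.restrict (Set.Ico 0 B)))
      atTop (𝓝 0) := by
  have : Fact (0 < B) := ⟨hB⟩
  have hG : MemLp (AddCircle.liftIoc B 0 f) 2 AddCircle.haarAddCircle :=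
    (MemLp.memLp_liftIoc (hf.restrict _)).haarAddCircle
  set g : Lp ℂ 2 (@AddCircle.haarAddCircle B _) := hG.toLp _ with hg
  have hcoef : ∀ m, fourierCoeff g m = (B : ℂ)⁻¹ * ∫ γ, expi (-(γ * m / B)) * f γ := by
    intro m
    rw [fourierCoeff_congr_ae hG.coeFn_toLp]
    exact fourierCoeff_eq_integral_expi (fun x hx => AddCircle.liftIoc_coe_apply
      ⟨hx.1, by simpa using hx.2.le⟩) hf0 m
  set D : Finset ℤ → Lp ℂ 2 (@AddCircle.haarAddCircle B _) := fun s =>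
    g - ∑ m ∈ s, fourierCoeff g m • fourierLp 2 m with hD
  -- The constant `B ^ (1/2)` arises because `haarAddCircle` is a probability measure while the
  -- interval has length `B`.
  have hnorm : ∀ s, eLpNorm (fourierRemainder B f s) 2 (volume.restrict (Set.Ico 0 B)) =
      ENNReal.ofReal B ^ (1 / (2 : ℝ≥0∞)).toReal * ‖D s‖ₑ := by
    intro s
    have hae : D s =ᵐ[AddCircle.haarAddCircle] fun x => AddCircle.liftIoc B 0 f x -
        ∑ m ∈ s, fourierCoeff g m * fourier m x := by
      have h1 : ∀ᵐ x ∂(@AddCircle.haarAddCircle B _), ∀ m : ℤ,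
          (fourierCoeff g m • fourierLp 2 m : Lp ℂ 2 (@AddCircle.haarAddCircle B _)) x =
          fourierCoeff g m * fourier m x := by
        rw [ae_all_iff]
        intro m
        filter_upwards [Lp.coeFn_smul (fourierCoeff g m)
          (fourierLp 2 m : Lp ℂ 2 (@AddCircle.haarAddCircle B _)), coeFn_fourierLp 2 m] with x h1 h2
        rw [h1, Pi.smul_apply, h2, smul_eq_mul]
      filter_upwards [Lp.coeFn_sub g (∑ m ∈ s, fourierCoeff g m • fourierLp 2 m),
        Lp.coeFn_finsetSum s (fun m => (fourierCoeff g m • fourierLp 2 m :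
          Lp ℂ 2 (@AddCircle.haarAddCircle B _))), hG.coeFn_toLp, h1] with x h2 h3 h4 h5
      rw [hD, h2, Pi.sub_apply, h3, h4]
      simp [h5]
    have hmeas : AEStronglyMeasurable (fun x : AddCircle B => AddCircle.liftIoc B 0 f x -
        ∑ m ∈ s, fourierCoeff g m * fourier m x) AddCircle.haarAddCircle :=
      (Lp.aestronglyMeasurable (D s)).congr hae
    rw [Lp.enorm_def, eLpNorm_congr_ae hae, ← smul_eq_mul,
      ← eLpNorm_smul_measure_of_ne_top (by simp), ← AddCircle.volume_eq_smul_haarAddCircle,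
      ← eLpNorm_comp_measurePreserving (f := fun x : ℝ => (x : AddCircle B)) (p := 2) ?_
        (AddCircle.measurePreserving_mk B 0)]
    · rw [zero_add, restrict_Ico_eq_restrict_Ioc]
      refine eLpNorm_congr_ae ((ae_restrict_mem measurableSet_Ioc).mono fun x hx => ?_)
      simp only [fourierRemainder, Function.comp_apply, hcoef, fourier_coe_eq_expi]
      rw [AddCircle.liftIoc_coe_apply (by simpa using hx)]
      congr 1
      exact Finset.sum_congr rfl fun m _ => by ring
    · rw [AddCircle.volume_eq_smul_haarAddCircle]
      exact hmeas.smul_measure _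
  have h0 : fourierRemainder B f ∅ = f := by
    ext x; simp [fourierRemainder]
  constructor
  · intro s
    rw [← h0, hnorm, h0, hnorm]
    gcongr
    rw [enorm_le_iff_norm_le]
    have := orthonormal_fourier.norm_sub_sum_inner_smul_le g s
    have h2 : ∀ m, inner ℂ (fourierLp 2 m) g = fourierCoeff g m := fun m => by
      rw [← fourierBasis_repr, HilbertBasis.repr_apply_apply, coe_fourierBasis]
    simpa [hD, h2] using this
  · have h1 : Tendsto D atTop (𝓝 0) := by
      have := (hasSum_fourier_series_L2 g).const_sub g
      simpa [hD] using this
    simp only [hnorm]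
    have h2 := ENNReal.Tendsto.const_mul (a := ENNReal.ofReal B ^ (1 / (2 : ℝ≥0∞)).toReal)
      h1.enorm (Or.inr (by finiteness))
    simpa using h2

theorem eLpNorm_two_sq {α : Type*} [MeasurableSpace α] (f : α → ℂ) (μ : Measure α) :
    eLpNorm f 2 μ ^ (2 : ℝ) = ∫⁻ x, ‖f x‖ₑ ^ (2 : ℝ) ∂μ :=
  eLpNorm_nnreal_pow_eq_lintegral (p := 2) (by norm_num)

theorem aestronglyMeasurable_fourier_snd (B : ℝ) {h : ℝ × ℝ → ℂ} (hh : AEStronglyMeasurable h)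
    (s : Finset ℤ) : AEStronglyMeasurable fun p : ℝ × ℝ => h p - ∑ m ∈ s,
      (B : ℂ)⁻¹ * expi (p.2 * m / B) * ∫ γ, expi (-(γ * m / B)) * h (p.1, γ) := by
  refine hh.sub ?_
  refine Finset.aestronglyMeasurable_fun_sum _ fun m _ => ?_
  have h1 : AEStronglyMeasurable (fun p : ℝ × ℝ => expi (-(p.2 * m / B)) * h p) :=
    (by fun_prop : Continuous fun p : ℝ × ℝ => expi (-(p.2 * m / B))).aestronglyMeasurable.mul hh
  have h2 : AEStronglyMeasurable (fun t : ℝ => ∫ γ, expi (-(γ * m / B)) * h (t, γ)) :=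
    AEStronglyMeasurable.integral_prod_right' h1
  exact (by fun_prop : Continuous fun p : ℝ × ℝ =>
    (B : ℂ)⁻¹ * expi (p.2 * m / B)).aestronglyMeasurable.mul h2.comp_fst

/-- The Fourier series in the second variable of a square-integrable function converges in `L²`. -/
theorem tendsto_eLpNorm_fourier_snd {T B : ℝ} (hB : 0 < B) {h : ℝ × ℝ → ℂ} (hh : MemLp h 2)
    (hh0 : ∀ p ∉ cell T B, h p = 0) :
    Tendsto (fun s : Finset ℤ => eLpNorm (fun p : ℝ × ℝ => h p - ∑ m ∈ s,
      (B : ℂ)⁻¹ * expi (p.2 * m / B) * ∫ γ, expi (-(γ * m / B)) * h (p.1, γ)) 2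
      (volume.restrict (cell T B))) atTop (𝓝 0) := by
  set E : Finset ℤ → ℝ × ℝ → ℂ := fun s p => fourierRemainder B (fun γ => h (p.1, γ)) s p.2 with hE
  have hvol : (volume.restrict (cell T B)) =
      (volume.restrict (Set.Ico 0 T)).prod (volume.restrict (Set.Ico 0 B)) := by
    rw [cell, Measure.prod_restrict, Measure.volume_eq_prod]
  have hEm : ∀ s, AEStronglyMeasurable (E s) := aestronglyMeasurable_fourier_snd B hh.1
  have hEm' : ∀ s, AEMeasurable (fun p => ‖E s p‖ₑ ^ (2 : ℝ))
      ((volume.restrict (Set.Ico 0 T)).prod (volume.restrict (Set.Ico 0 B))) := fun s => by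
    rw [← hvol]
    exact (hEm s).restrict.enorm.pow_const _
  have hfin : ∫⁻ t, ∫⁻ γ, ‖h (t, γ)‖ₑ ^ (2 : ℝ) ≠ ⊤ := by
    rw [← lintegral_prod (μ := volume) (ν := volume) (fun p : ℝ × ℝ => ‖h p‖ₑ ^ (2 : ℝ))
      (hh.1.enorm.pow_const _), ← Measure.volume_eq_prod, ← eLpNorm_two_sq]
    exact ENNReal.rpow_ne_top_of_nonneg (by norm_num) hh.2.ne
  have hslice : ∀ᵐ t : ℝ, MemLp (fun γ => h (t, γ)) 2 := by
    have h1 : ∀ᵐ t : ℝ, ∫⁻ γ, ‖h (t, γ)‖ₑ ^ (2 : ℝ) < ⊤ :=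
      ae_lt_top' (AEMeasurable.lintegral_prod_right' (hh.1.enorm.pow_const _)) hfin
    have h2 : ∀ᵐ t : ℝ, AEStronglyMeasurable (fun γ => h (t, γ)) :=
      AEStronglyMeasurable.prodMk_left hh.1
    filter_upwards [h1, h2] with t ht1 ht2
    refine ⟨ht2, ?_⟩
    rw [← eLpNorm_two_sq] at ht1
    exact (ENNReal.rpow_lt_top_iff_of_pos (by norm_num)).1 ht1
  have hh0' : ∀ t γ, γ ∉ Set.Ico 0 B → h (t, γ) = 0 := fun t γ hγ => hh0 _ fun hm => hγ hm.2
  -- Dominated convergence in `t`, along finite subsets of `ℤ`; this filter is countably generated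
  -- because `ℤ` is countable.
  have hint : Tendsto (fun s => ∫⁻ t in Set.Ico 0 T, ∫⁻ γ in Set.Ico 0 B, ‖E s (t, γ)‖ₑ ^ (2 : ℝ))
      atTop (𝓝 (∫⁻ t in Set.Ico 0 T, 0)) := by
    refine tendsto_lintegral_filter_of_dominated_convergence'
      (fun t => ∫⁻ γ in Set.Ico 0 B, ‖h (t, γ)‖ₑ ^ (2 : ℝ))
      (Eventually.of_forall fun s => (hEm' s).lintegral_prod_right')
      (Eventually.of_forall fun s => ?_) ?_ ?_
    · filter_upwards [ae_restrict_of_ae hslice] with t ht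
      have := (eLpNorm_fourierRemainder hB ht (hh0' t)).1 s
      rw [← eLpNorm_two_sq, ← eLpNorm_two_sq]
      exact ENNReal.rpow_le_rpow this (by norm_num)
    · refine ne_top_of_le_ne_top hfin ((lintegral_mono fun t => ?_).trans
        (setLIntegral_le_lintegral _ _))
      exact setLIntegral_le_lintegral _ _
    · filter_upwards [ae_restrict_of_ae hslice] with t ht
      have := (eLpNorm_fourierRemainder hB ht (hh0' t)).2
      have h2 := this.ennrpow_const (2 : ℝ)
      rw [ENNReal.zero_rpow_of_pos (by norm_num)] at h2
      simpa only [eLpNorm_two_sq] using h2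
  rw [lintegral_zero] at hint
  have heq : ∀ s, eLpNorm (E s) 2 (volume.restrict (cell T B)) =
      (∫⁻ t in Set.Ico 0 T, ∫⁻ γ in Set.Ico 0 B, ‖E s (t, γ)‖ₑ ^ (2 : ℝ)) ^ (1 / 2 : ℝ) := by
    intro s
    rw [← lintegral_prod _ (hEm' s), ← hvol, ← eLpNorm_two_sq, ← ENNReal.rpow_mul]
    norm_num
  have h3 := hint.ennrpow_const (1 / 2 : ℝ)
  rw [ENNReal.zero_rpow_of_pos (by norm_num)] at h3
  simp only [← heq] at h3
  exact h3

/-! ### Reconstruction and identification. -/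

/-- The combination of patches, modulated to the residue class `r`. -/
noncomputable def modulatedMix (c : ℤ → ℂ) (T B : ℝ) {J : ℕ} (a b : Fin J → ℤ) (C : ℝ × ℝ → ℝ)
    (r : Fin J) (p : ℝ × ℝ) : ℂ :=
  expi (-(p.2 * (T * (r : ℕ)))) * patchMix c T B a b C r p

theorem expi_mul_modulatedMix (c : ℤ → ℂ) (T B : ℝ) {J : ℕ} (a b : Fin J → ℤ) (C : ℝ × ℝ → ℝ)
    (r : Fin J) (p : ℝ × ℝ) :
    expi (p.2 * (T * (r : ℕ))) * modulatedMix c T B a b C r p = patchMix c T B a b C r p := by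
  rw [modulatedMix, ← mul_assoc, ← expi_add, add_neg_cancel, expi_zero, one_mul]

theorem integrable_modulatedMix (c : ℤ → ℂ) {T B : ℝ} {J : ℕ} (a b : Fin J → ℤ) {C : ℝ × ℝ → ℝ}
    (hC : Integrable C) (r : Fin J) : Integrable (modulatedMix c T B a b C r) :=
  (integrable_patchMix c a b hC r).bdd_mul (c := 1) (by fun_prop : Continuous _).aestronglyMeasurable
    (Eventually.of_forall fun _ => (norm_expi _).le)

theorem memLp_modulatedMix (c : ℤ → ℂ) {T B : ℝ} {J : ℕ} (a b : Fin J → ℤ) {C : ℝ × ℝ → ℝ}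
    (hC : Integrable C) (hC2 : MemLp C 2) (r : Fin J) : MemLp (modulatedMix c T B a b C r) 2 :=
  (memLp_patchMix c a b hC2 r).of_le (integrable_modulatedMix c a b hC r).1
    (Eventually.of_forall fun p => by rw [modulatedMix, norm_mul, norm_expi, one_mul])

theorem modulatedMix_eq_zero (c : ℤ → ℂ) {T B : ℝ} {J : ℕ} (a b : Fin J → ℤ) (C : ℝ × ℝ → ℝ)
    (r : Fin J) {p : ℝ × ℝ} (hp : p ∉ cell T B) : modulatedMix c T B a b C r p = 0 := by
  rw [modulatedMix, patchMix_eq_zero c a b C r hp, mul_zero]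

/-- The terms of the reconstruction series are modulated terms of a Fourier series. -/
theorem ae_seriesTerm_eq {Ω : Type*} [MeasurableSpace Ω] {P : Measure Ω}
    {η : SpreadingFunction P} {C : ℝ × ℝ → ℝ} (hη : IsScatteringFunction η C) {c : ℤ → ℂ} {T B : ℝ}
    (hT : 0 < T) (hB : 0 < B) {J : ℕ} (hJ : J * T * B = 1) (hc : Function.Periodic c (J : ℤ))
    {a b : Fin J → ℤ} (hab : Function.Injective fun j => (a j, b j))
    (hC : Function.support C ⊆ cellUnion T B a b) {Pi : ℤ → ℝ → ℂ}
    (hPi : IsEchoAutocorrelation (echo η (deltaTrain c T)) T Pi) :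
    ∀ᵐ p : ℝ × ℝ, p.1 ∈ Set.Ioo 0 T → ∀ (r : Fin J) (m : ℤ), seriesTerm T B Pi r m p =
      expi (p.2 * (T * (r : ℕ))) * ((B : ℂ)⁻¹ * expi (p.2 * m / B) *
        ∫ γ, expi (-(γ * m / B)) * modulatedMix c T B a b C r (p.1, γ)) := by
  have h1 : ∀ᵐ t : ℝ, t ∈ Set.Ioo 0 T → ∀ n, Pi n t = echoACF c T C n t := by
    have : ∀ᵐ t ∂(volume.restrict (Set.Ioo 0 T)), ∀ n, Pi n t = echoACF c T C n t :=
      ae_all_iff.2 fun n => hPi.ae_eq hT (isEchoAutocorrelation_echoACF hη c hT) n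
    exact (ae_restrict_iff' measurableSet_Ioo).1 this
  have h2 : ∀ᵐ t : ℝ, ∀ j, Integrable fun γ => patch T B a b C j (t, γ) :=
    ae_all_iff.2 fun j => (integrable_patch a b hη.integrable j).prod_right_ae
  -- This form of `JTB = 1` splits frequency `T(mJ + r)` into the Fourier frequency `m / B` and a
  -- fixed modulation `T r`.
  have hBJ : B⁻¹ = J * T := by field_simp; linarith
  have hexp : ∀ (x : ℝ) (m : ℤ) (r : Fin J), x * T * (m * J + (r : ℕ)) =
      x * (T * (r : ℕ)) + x * m / B := by
    intro x m r
    rw [div_eq_mul_inv, hBJ]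
    ring
  have h3 : ∀ᵐ p : ℝ × ℝ, (p.1 ∈ Set.Ioo 0 T → ∀ n, Pi n p.1 = echoACF c T C n p.1) ∧
      ∀ j, Integrable fun γ => patch T B a b C j (p.1, γ) :=
    (Measure.quasiMeasurePreserving_fst (μ := (volume : Measure ℝ))
      (ν := (volume : Measure ℝ))).ae (h1.and h2)
  filter_upwards [h3] with p hp hpT r m
  have e : ∀ γ, expi (-(γ * T * (m * J + (r : ℕ)))) * patchMix c T B a b C r (p.1, γ) =
      expi (-(γ * m / B)) * modulatedMix c T B a b C r (p.1, γ) := fun γ => by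
    rw [hexp, neg_add, expi_add, modulatedMix]
    ring
  rw [seriesTerm, hp.1 hpT, echoACF_eq_integral_patchMix hT hB hJ hc hab hC hpT hp.2, hexp,
    expi_add]
  simp only [e]
  ring

theorem IsTestFunction.mul_expi {φ : ℝ × ℝ → ℂ} (hφ : IsTestFunction φ) (s : ℝ) :
    IsTestFunction fun p => φ p * expi (p.2 * s) :=
  ⟨hφ.1.mul (contDiff_expi.comp (by fun_prop)), hφ.2.mul_right⟩

/-- For each residue `r` the modulation is absorbed into the test function; the series then sums
weakly to `∑ j, A_{rj} C_j`, and applying `A⁻¹` isolates each patch. -/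
theorem weakReconstruction_of_isEchoAutocorrelation {Ω : Type*} [MeasurableSpace Ω] {P : Measure Ω}
    {η : SpreadingFunction P} {C : ℝ × ℝ → ℝ} (hη : IsScatteringFunction η C) {c : ℤ → ℂ} {T B : ℝ}
    (hT : 0 < T) (hB : 0 < B) {J : ℕ} (hJ : J * T * B = 1) (hc : Function.Periodic c (J : ℤ))
    {a b : Fin J → ℤ} (hab : Function.Injective fun j => (a j, b j))
    (hA : IsUnit (gaborMatrix c a b))
    (hC : Function.support C ⊆ cellUnion T B a b) {Pi : ℤ → ℝ → ℂ}
    (hPi : IsEchoAutocorrelation (echo η (deltaTrain c T)) T Pi) :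
    WeakReconstruction T B (gaborMatrix c a b)⁻¹ Pi (patch T B a b C) := by
  intro φ hφ hφs
  have hae := ae_seriesTerm_eq hη hT hB hJ hc hab hC hPi
  have hsum : ∀ r : Fin J, HasSum (fun m : ℤ => ∫ p, φ p * seriesTerm T B Pi r m p)
      (∫ p, φ p * patchMix c T B a b C r p) := by
    intro r
    have h1 := hasSum_integral_fourier_snd hB (integrable_modulatedMix c a b hη.integrable r)
      (fun p hp => modulatedMix_eq_zero c a b C r hp) (hφ.mul_expi (T * (r : ℕ)))
      ((tsupport_mul_subset_left).trans hφs)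
    have h2 : ∀ p, φ p * expi (p.2 * (T * (r : ℕ))) * modulatedMix c T B a b C r p =
        φ p * patchMix c T B a b C r p := fun p => by
      rw [mul_assoc, expi_mul_modulatedMix]
    simp only [h2] at h1
    refine h1.congr_fun fun m => integral_congr_ae ?_
    filter_upwards [hae] with p hp
    by_cases hp1 : p.1 ∈ Set.Ioo 0 T
    · rw [hp hp1 r m, ← mul_assoc (φ p)]
    · simp [eq_zero_of_tsupport_subset hφs fun h => hp1 h.1]
  refine ⟨fun r m => ?_, fun r => (hsum r).summable, fun j => ?_⟩
  · simp only [seriesTerm, mul_assoc]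
    simp only [← mul_assoc (B : ℂ)⁻¹]
    exact integrable_testFunction_mul_fst hφ hφs (hPi _).1 _ _
  · simp only [(hsum _).tsum_eq, patch_eq_sum_patchMix hA C j, Finset.mul_sum]
    rw [integral_finsetSum]
    · refine Finset.sum_congr rfl fun r _ => ?_
      rw [← integral_const_mul]
      congr 1
      ext p
      ring
    · intro r _
      obtain ⟨K, hK⟩ := hφ.exists_bound
      exact ((integrable_patchMix c a b hη.integrable r).const_mul _).bdd_mul (c := K)
        hφ.1.continuous.aestronglyMeasurable (Eventually.of_forall hK)

/-- Discards the edges by which the half-open cell differs from the open rectangle, where the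
autocorrelations and test functions live. -/
theorem ae_fst_ne_zero_and_snd_ne_zero : ∀ᵐ p : ℝ × ℝ, p.1 ≠ 0 ∧ p.2 ≠ 0 :=
  ((Measure.quasiMeasurePreserving_fst (μ := (volume : Measure ℝ)) (ν := (volume : Measure ℝ))).ae
    (Measure.ae_ne volume 0)).and ((Measure.quasiMeasurePreserving_snd
      (μ := (volume : Measure ℝ)) (ν := (volume : Measure ℝ))).ae (Measure.ae_ne volume 0))

theorem l2Reconstruction_of_isEchoAutocorrelation {Ω : Type*} [MeasurableSpace Ω] {P : Measure Ω}
    {η : SpreadingFunction P} {C : ℝ × ℝ → ℝ} (hη : IsScatteringFunction η C) {c : ℤ → ℂ} {T B : ℝ}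
    (hT : 0 < T) (hB : 0 < B) {J : ℕ} (hJ : J * T * B = 1) (hc : Function.Periodic c (J : ℤ))
    {a b : Fin J → ℤ} (hab : Function.Injective fun j => (a j, b j))
    (hA : IsUnit (gaborMatrix c a b))
    (hC : Function.support C ⊆ cellUnion T B a b) {Pi : ℤ → ℝ → ℂ}
    (hPi : IsEchoAutocorrelation (echo η (deltaTrain c T)) T Pi) (hC2 : MemLp C 2) :
    L2Reconstruction T B (gaborMatrix c a b)⁻¹ Pi (patch T B a b C) := by
  intro j
  set V := (gaborMatrix c a b)⁻¹ with hV
  set E : Fin J → Finset ℤ → ℝ × ℝ → ℂ := fun r s p => modulatedMix c T B a b C r p - ∑ m ∈ s,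
    (B : ℂ)⁻¹ * expi (p.2 * m / B) *
      ∫ γ, expi (-(γ * m / B)) * modulatedMix c T B a b C r (p.1, γ) with hE
  have hEm : ∀ r s, AEStronglyMeasurable (E r s) := fun r s =>
    aestronglyMeasurable_fourier_snd B (integrable_modulatedMix c a b hη.integrable r).1 s
  have hlim : ∀ r, Tendsto (fun s => eLpNorm (E r s) 2 (volume.restrict (cell T B))) atTop (𝓝 0) :=
    fun r => tendsto_eLpNorm_fourier_snd hB (memLp_modulatedMix c a b hη.integrable hC2 r)
      (fun p hp => modulatedMix_eq_zero c a b C r hp)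
  -- Modulation preserves norms, so the error is at most a fixed finite combination of the Fourier
  -- remainders of the `J` residue classes.
  have hbound : ∀ s : Finset ℤ, eLpNorm (fun p => patch T B a b C j p -
      ∑ r : Fin J, V j r * ∑ m ∈ s, seriesTerm T B Pi r m p) 2 (volume.restrict (cell T B)) ≤
      ∑ r, ‖V j r‖ₑ * eLpNorm (E r s) 2 (volume.restrict (cell T B)) := by
    intro s
    have h1 : (fun p => patch T B a b C j p -
        ∑ r : Fin J, V j r * ∑ m ∈ s, seriesTerm T B Pi r m p) =ᵐ[volume.restrict (cell T B)]
        ∑ r, fun p => V j r * (expi (p.2 * (T * (r : ℕ))) * E r s p) := by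
      filter_upwards [ae_restrict_mem (measurableSet_cell T B),
        ae_restrict_of_ae ae_fst_ne_zero_and_snd_ne_zero,
        ae_restrict_of_ae (ae_seriesTerm_eq hη hT hB hJ hc hab hC hPi)] with p hp hp0 hps
      have hp1 : p.1 ∈ Set.Ioo 0 T := ⟨lt_of_le_of_ne hp.1.1 hp0.1.symm, hp.1.2⟩
      rw [patch_eq_sum_patchMix hA C j p, ← Finset.sum_sub_distrib, Finset.sum_apply]
      refine Finset.sum_congr rfl fun r _ => ?_
      simp only [hps hp1 r, hE]
      rw [← Finset.mul_sum, mul_sub (expi _), expi_mul_modulatedMix, mul_sub]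
    rw [eLpNorm_congr_ae h1]
    refine (eLpNorm_sum_le (fun r _ => ?_) (by norm_num)).trans (Finset.sum_le_sum fun r _ => ?_)
    · exact ((by fun_prop : Continuous fun p : ℝ × ℝ =>
        expi (p.2 * (T * (r : ℕ)))).aestronglyMeasurable.mul (hEm r s).restrict).const_mul _
    · have h2 : eLpNorm (fun p => V j r * (expi (p.2 * (T * (r : ℕ))) * E r s p)) 2
          (volume.restrict (cell T B)) = eLpNorm (V j r • E r s) 2 (volume.restrict (cell T B)) :=
        eLpNorm_congr_norm_ae (Eventually.of_forall fun p => by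
          simp [norm_expi])
      rw [h2, eLpNorm_const_smul]
  refine tendsto_of_tendsto_of_tendsto_of_le_of_le tendsto_const_nhds ?_ (fun _ => bot_le) hbound
  have := tendsto_finsetSum Finset.univ fun r (_ : r ∈ Finset.univ) =>
    ENNReal.Tendsto.const_mul (a := ‖V j r‖ₑ) (hlim r) (Or.inr (by finiteness))
  simpa using this

/-- The weak reconstruction formula determines the patches. -/
theorem WeakReconstruction.ae_eq {T B : ℝ} {J : ℕ} {V : Matrix (Fin J) (Fin J) ℂ}
    {Pi : ℤ → ℝ → ℂ} {F F' : Fin J → ℝ × ℝ → ℂ} (h : WeakReconstruction T B V Pi F)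
    (h' : WeakReconstruction T B V Pi F') (hF : ∀ j, Integrable (F j))
    (hF' : ∀ j, Integrable (F' j)) (j : Fin J) :
    ∀ᵐ p : ℝ × ℝ, p ∈ Set.Ioo 0 T ×ˢ Set.Ioo 0 B → F j p = F' j p := by
  have key := (isOpen_Ioo.prod isOpen_Ioo).ae_eq_zero_of_integral_contDiff_smul_eq_zero
    (U := Set.Ioo 0 T ×ˢ Set.Ioo 0 B) (μ := volume) (f := fun p => F j p - F' j p)
    (((hF j).sub (hF' j)).locallyIntegrable.locallyIntegrableOn _) ?_
  · filter_upwards [key] with p hp hmem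
    exact sub_eq_zero.1 (hp hmem)
  intro g hg hgc hgs
  have hφ : IsTestFunction fun p => (g p : ℂ) :=
    ⟨Complex.ofRealCLM.contDiff.comp hg, hgc.comp_left Complex.ofReal_zero⟩
  have hφs := (tsupport_comp_subset Complex.ofReal_zero g).trans hgs
  obtain ⟨K, hK⟩ := hφ.exists_bound
  have hi : ∀ {f : ℝ × ℝ → ℂ}, Integrable f → Integrable fun p => (g p : ℂ) * f p := fun hf =>
    hf.bdd_mul (c := K) hφ.1.continuous.aestronglyMeasurable (Eventually.of_forall hK)
  simp only [Complex.real_smul, mul_sub]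
  rw [integral_sub (hi (hF j)) (hi (hF' j)), (h _ hφ hφs).2.2 j, (h' _ hφ hφs).2.2 j, sub_self]

/-- The echo autocorrelation determines the scattering function. -/
theorem ae_eq_of_sameAutocorrelation {Ω₁ Ω₂ : Type*} [MeasurableSpace Ω₁] [MeasurableSpace Ω₂]
    {P₁ : Measure Ω₁} {P₂ : Measure Ω₂} {η₁ : SpreadingFunction P₁} {η₂ : SpreadingFunction P₂}
    {C₁ C₂ : ℝ × ℝ → ℝ} (h₁ : IsScatteringFunction η₁ C₁) (h₂ : IsScatteringFunction η₂ C₂)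
    {c : ℤ → ℂ} {T B : ℝ}
    (hT : 0 < T) (hB : 0 < B) {J : ℕ} (hJ : J * T * B = 1) (hc : Function.Periodic c (J : ℤ))
    {a b : Fin J → ℤ} (hab : Function.Injective fun j => (a j, b j))
    (hA : IsUnit (gaborMatrix c a b))
    (hC₁ : Function.support C₁ ⊆ cellUnion T B a b) (hC₂ : Function.support C₂ ⊆ cellUnion T B a b)
    (h : SameAutocorrelation (echo η₁ (deltaTrain c T)) (echo η₂ (deltaTrain c T))) :
    C₁ =ᵐ[volume] C₂ := by
  have hPi₁ := isEchoAutocorrelation_echoACF h₁ c hT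
  -- The functions computed from `C₁` also represent the second echo, so both families of patches
  -- are reconstructed from the same data.
  have hPi₂ : IsEchoAutocorrelation (echo η₂ (deltaTrain c T)) T (echoACF c T C₁) := fun n =>
    ⟨(hPi₁ n).1, fun φ ψ hφ hψ hφT hψT => by
      rw [← h _ _ (hφ.comp_sub_const _) hψ]
      exact (hPi₁ n).2 φ ψ hφ hψ hφT hψT⟩
  have hw₁ := weakReconstruction_of_isEchoAutocorrelation h₁ hT hB hJ hc hab hA hC₁ hPi₁
  have hw₂ := weakReconstruction_of_isEchoAutocorrelation h₂ hT hB hJ hc hab hA hC₂ hPi₂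
  have hpatch : ∀ j, ∀ᵐ p : ℝ × ℝ, patch T B a b C₁ j p = patch T B a b C₂ j p := by
    intro j
    filter_upwards [hw₁.ae_eq hw₂ (integrable_patch a b h₁.integrable)
      (integrable_patch a b h₂.integrable) j, ae_fst_ne_zero_and_snd_ne_zero] with p hp hp0
    by_cases hpc : p ∈ cell T B
    · exact hp ⟨⟨lt_of_le_of_ne hpc.1.1 hp0.1.symm, hpc.1.2⟩,
        lt_of_le_of_ne hpc.2.1 hp0.2.symm, hpc.2.2⟩
    · rw [patch, patch, Set.indicator_of_notMem hpc, Set.indicator_of_notMem hpc]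
  have hshift : ∀ᵐ p : ℝ × ℝ, ∀ j, patch T B a b C₁ j (p.1 - a j * T, p.2 - b j * B) =
      patch T B a b C₂ j (p.1 - a j * T, p.2 - b j * B) :=
    ae_all_iff.2 fun j => (measurePreserving_sub_right volume
      ((a j * T, b j * B) : ℝ × ℝ)).quasiMeasurePreserving.ae (hpatch j)
  filter_upwards [hshift] with p hp
  have : (C₁ p : ℂ) = C₂ p := by
    rw [eq_sum_patch hT hB hab hC₁, eq_sum_patch hT hB hab hC₂]
    exact Finset.sum_congr rfl fun j _ => hp j
  exact_mod_cast this

theorem theorem1 (S : Set (ℝ × ℝ)) (hS : IsCompact S) (hM : volume S < 1) :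
    ∃ (T B : ℝ) (J : ℕ) (c : ℤ → ℂ) (a b : Fin J → ℤ),
      0 < T ∧ 0 < B ∧ J.Prime ∧ J * T * B = 1 ∧ Function.Periodic c (J : ℤ) ∧
      S ⊆ cellUnion T B a b ∧ IsUnit (gaborMatrix c a b) ∧
      -- the scattering function is determined by the autocorrelation of the echo
      (∀ (Ω₁ Ω₂ : Type*) [MeasurableSpace Ω₁] [MeasurableSpace Ω₂]
        (P₁ : Measure Ω₁) (P₂ : Measure Ω₂) [IsProbabilityMeasure P₁] [IsProbabilityMeasure P₂]
        (η₁ : SpreadingFunction P₁) (η₂ : SpreadingFunction P₂) (C₁ C₂ : ℝ × ℝ → ℝ),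
        IsScatteringFunction η₁ C₁ → IsScatteringFunction η₂ C₂ →
        Function.support C₁ ⊆ cellUnion T B a b → Function.support C₂ ⊆ cellUnion T B a b →
        SameAutocorrelation (echo η₁ (deltaTrain c T)) (echo η₂ (deltaTrain c T)) →
        C₁ =ᵐ[volume] C₂) ∧
      -- the explicit reconstruction from the echo autocorrelations
      (∀ (Ω : Type*) [MeasurableSpace Ω] (P : Measure Ω) [IsProbabilityMeasure P]
        (η : SpreadingFunction P) (C : ℝ × ℝ → ℝ),
        IsScatteringFunction η C → Function.support C ⊆ cellUnion T B a b →
        IsEchoAutocorrelation (echo η (deltaTrain c T)) T (echoACF c T C) ∧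
        (∀ p : ℝ × ℝ, (C p : ℂ) =
          ∑ j : Fin J, patch T B a b C j (p.1 - a j * T, p.2 - b j * B)) ∧
        ∀ Pi : ℤ → ℝ → ℂ, IsEchoAutocorrelation (echo η (deltaTrain c T)) T Pi →
          WeakReconstruction T B (gaborMatrix c a b)⁻¹ Pi (patch T B a b C) ∧
          (MemLp C 2 volume →
            L2Reconstruction T B (gaborMatrix c a b)⁻¹ Pi (patch T B a b C))) := by
  obtain ⟨T, B, J, c, a, b, hT, hB, hJp, hJ, hc, hS', hA, hab⟩ :=
    exists_cover_isUnit_gaborMatrix hS hM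
  refine ⟨T, B, J, c, a, b, hT, hB, hJp, hJ, hc, hS', hA, ?_, ?_⟩
  · intro Ω₁ Ω₂ _ _ P₁ P₂ _ _ η₁ η₂ C₁ C₂ h₁ h₂ hC₁ hC₂ h
    exact ae_eq_of_sameAutocorrelation h₁ h₂ hT hB hJ hc hab hA hC₁ hC₂ h
  · intro Ω _ P _ η C hη hC
    exact ⟨isEchoAutocorrelation_echoACF hη c hT, eq_sum_patch hT hB hab hC, fun Pi hPi =>
      ⟨weakReconstruction_of_isEchoAutocorrelation hη hT hB hJ hc hab hA hC hPi,
        l2Reconstruction_of_isEchoAutocorrelation hη hT hB hJ hc hab hA hC hPi⟩⟩
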